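/- For a Boolean function $f$ of $n$ variables with exactly $k$ zeros, a zero matrix $M_f\in\{0,1\}^{k\times n}$ is a matrix whose rows are all the zeros of $f$, each listed once. Call $f$ reduced if the columns of $M_f$ are non-constant and pairwise distinct, and no column is the negation of a column. Let $P_k^n$ be the class of Boolean functions of $n$ variables with exactly $k$ zeros. A complete function $\phi_k$ is a reduced function in $P_k^{2^{k-1}-1}$. The weight of a vector in $\{0,1\}^k$ is the minimum of its number of ones and its number of zeros. For a Boolean function $f$ let $L(f)$ be the number of literal occurrences in a minimal DNF of $f$, i.e. the minimum, over all disjunctive normal forms of $f$, of the total number of literals in its conjunctions. For $k\ge 1$ let $h_k$ be a reduced Boolean function with $k$ zeros whose zero matrix $H_k$ has the largest possible number $n_k$ of columns among all zero matrices of reduced functions with $k$ zeros all of whose columns have weight at least $k/2-\sqrt{k\ln k}$. Such functions $h_k$ and complete functions $\phi_k$ exist for every $k\ge1$, and for every choice of them: 1. For every $k\ge 1$, $n_k\ge 2^{k-1}\left(1-\frac2k\right)$. 2. For every $k\ge1$ with $\frac{2\sqrt{k\ln k}}{k}\le\frac14$, $$L(h_k)>2^{k-1}\left(\frac{10}{3}-\frac53\cdot\frac{2\ln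 k}{\sqrt k+2\ln k}\right)\left(1-\frac2k\right),$$ and there is a sequence $\delta_k\to0$, independent of the choice of $h_k$, with $L(h_k)>\frac{10}{3}\cdot2^{k-1}(1+\delta_k)$ for all $k\ge1$. 3. There is a sequence $\delta_k\to0$, independent of the choice of $\phi_k$, with $L(\phi_k)\le 3\cdot2^{k-1}(1+\delta_k)$ for all $k\ge1$. 4. For every real $c<\frac{10}{9}$ and all sufficiently large $k$ (depending only on $c$), $L(h_k)>c\,L(\phi_k)$ for every choice of $h_k$ and $\phi_k$. 5. The complete function is not (even asymptotically) the most complex function in its class $P_k^{2^{k-1}-1}$: there are a sequence $\delta_k\to 0$ and functions $g_k\in P_k^{2^{k-1}-1}$ with $L(g_k)>\frac{10}{3}\cdot2^{k-1}(1+\delta_k)$ for all $k\ge1$; and for every real $c<\frac{10}{9}$ and all sufficiently large $k$ there is $g\in P_k^{2^{k-1}-1}$ with $L(g)>c\,L(\phi_k)$ for every complete function $\phi_k$. -/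

import Mathlib

open Filter Topology

/-- A Boolean function of `n` variables. -/
abbrev BoolFn (n : ℕ) : Type := (Fin n → Bool) → Bool

/-- A literal: `(j, true)` is the variable `x_j`, `(j, false)` is its negation. -/
abbrev Lit (n : ℕ) : Type := Fin n × Bool

/-- A conjunction, as the set of its literals. -/
abbrev Conj (n : ℕ) : Type := Finset (Lit n)

/-- A disjunctive normal form, as the set of its conjunctions. -/
abbrev DNF (n : ℕ) : Type := Finset (Conj n)

/-- The conjunction takes the value `1` at the point `x`. -/
def Conj.Holds {n : ℕ} (K : Conj n) (x : Fin n → Bool) : Prop :=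
  ∀ l ∈ K, x l.1 = l.2

/-- An elementary conjunction does not contain a variable together with its negation. -/
def Conj.IsElementary {n : ℕ} (K : Conj n) : Prop :=
  ∀ j : Fin n, ¬ ((j, true) ∈ K ∧ (j, false) ∈ K)

/-- The number of literals that occur in a DNF. -/
def DNF.rank {n : ℕ} (D : DNF n) : ℕ := ∑ K ∈ D, K.card

/-- `D` is a DNF, made of elementary conjunctions, of the function `f`. -/
def DNF.Realizes {n : ℕ} (D : DNF n) (f : BoolFn n) : Prop :=
  (∀ K ∈ D, Conj.IsElementary K) ∧ ∀ x, f x = true ↔ ∃ K ∈ D, Conj.Holds K x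

/-- Every Boolean function has a DNF, so that the minimum below is over a non-empty set. -/
theorem exists_dnf_realizes {n : ℕ} (f : BoolFn n) : ∃ D : DNF n, DNF.Realizes D f := by
  classical
  refine ⟨(Finset.univ.filter fun x => f x = true).image
    fun x => Finset.univ.image fun j => (j, x j), ?_, ?_⟩
  · intro K hK j h
    simp only [Finset.mem_image, Finset.mem_filter, Finset.mem_univ, true_and] at hK
    obtain ⟨x, -, rfl⟩ := hK
    simp only [Finset.mem_image, Finset.mem_univ, true_and, Prod.mk.injEq] at h
    obtain ⟨⟨a, rfl, h1⟩, ⟨b, hb, h2⟩⟩ := h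
    subst hb
    simp [h1] at h2
  · intro x
    constructor
    · intro hx
      refine ⟨Finset.univ.image fun j => (j, x j), ?_, ?_⟩
      · exact Finset.mem_image.2 ⟨x, by simpa using hx, rfl⟩
      · intro l hl
        simp only [Finset.mem_image, Finset.mem_univ, true_and] at hl
        obtain ⟨j, rfl⟩ := hl
        rfl
    · rintro ⟨K, hK, h⟩
      simp only [Finset.mem_image, Finset.mem_filter, Finset.mem_univ, true_and] at hK
      obtain ⟨y, hy, rfl⟩ := hK
      have : x = y := by
        funext j
        exact h (j, y j) (Finset.mem_image.2 ⟨j, Finset.mem_univ _, rfl⟩)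
      rw [this]
      exact hy

/-- The number of literals in a minimal DNF of `f`. -/
noncomputable def minRank {n : ℕ} (f : BoolFn n) : ℕ :=
  sInf {r : ℕ | ∃ D : DNF n, DNF.Realizes D f ∧ DNF.rank D = r}

/-- `zeroClass k n`: the Boolean functions of `n` variables with exactly `k` zeros. -/
def zeroClass (k n : ℕ) : Set (BoolFn n) :=
  {f | (Finset.univ.filter fun x => f x = false).card = k}

/-- `M` is a zero matrix of `f`: its rows are all the zeros of `f`, each listed once. -/
def IsZeroMatrix {k n : ℕ} (M : Matrix (Fin k) (Fin n) Bool) (f : BoolFn n) : Prop :=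
  Function.Injective (fun i => M i) ∧ ∀ x, f x = false ↔ ∃ i, M i = x

/-- The columns of `M` are non-constant, pairwise distinct, and none is the negation of one
of them. -/
structure HasReducedColumns {k n : ℕ} (M : Matrix (Fin k) (Fin n) Bool) : Prop where
  exists_one : ∀ j, ∃ i, M i j = true
  exists_zero : ∀ j, ∃ i, M i j = false
  distinct : ∀ j j', j ≠ j' → ∃ i, M i j ≠ M i j'
  not_negation : ∀ j j', ∃ i, M i j ≠ !(M i j')

/-- A complete function: a reduced function of `2 ^ (k - 1) - 1` variables with exactly `k`
zeros. -/
def IsCompleteFn (k : ℕ) (φ : BoolFn (2 ^ (k - 1) - 1)) : Prop :=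
  ∃ M : Matrix (Fin k) (Fin (2 ^ (k - 1) - 1)) Bool, IsZeroMatrix M φ ∧ HasReducedColumns M

/-- The weight of a Boolean vector: the minimum of its numbers of ones and of zeros. -/
def weight {k : ℕ} (v : Fin k → Bool) : ℕ :=
  min (Finset.univ.filter fun i => v i = true).card
    (Finset.univ.filter fun i => v i = false).card

/-- `M` has distinct rows, reduced columns, and every column has weight at least
`k / 2 - √(k ln k)`. -/
structure IsBalanced {k n : ℕ} (M : Matrix (Fin k) (Fin n) Bool) : Prop where
  rows : Function.Injective (fun i => M i)
  columns : HasReducedColumns M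
  weight_ge : ∀ j, (k : ℝ) / 2 - √((k : ℝ) * Real.log k) ≤ (weight fun i => M i j : ℕ)

/-- The zero matrix of `h` is a matrix with `k` rows which, among the matrices `M` with
`IsBalanced M`, has the largest possible number of columns. -/
def IsExtremal (k : ℕ) {n : ℕ} (h : BoolFn n) : Prop :=
  ∃ H : Matrix (Fin k) (Fin n) Bool, IsZeroMatrix H h ∧ IsBalanced H ∧
    ∀ (n' : ℕ) (H' : Matrix (Fin k) (Fin n') Bool), IsBalanced H' → n' ≤ n

/-!
A literal is false at some of the zeros of a function, and the literals of a reduced function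
correspond to distinct sets of zeros.

*Lower bound.* If any two zeros differ in at least two coordinates, then flipping one coordinate of
a zero gives a point of value `1`, and in a conjunction that holds there the flipped literal is the
only one that is false at the zero. So every zero at which a literal is false is private to the
literal in some conjunction. A literal that occurs only once has all its zeros private; when all
columns are nearly balanced, it takes up almost half of the zeros of its conjunction, and each of
the at least two other literals in the conjunction has hardly any private zeros there, hence needs
other occurrences to make its zeros private. Weighing the literals by their numbers of occurrences
gives `5 / 3` occurrences per literal, that is `10 / 3` per column. By an exponential moment bound,
almost all sets are nearly balanced, so the balanced matrices lose only a factor `1 - 2 / k` in the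
number of columns.

*Upper bound.* For a complete function every proper non-empty set of zeros belongs to a literal. A
point of the cube picks one set out of each complementary pair, and it is a zero when the picked
sets are those that avoid a fixed index. Three-block partitions `{C, B \ C, Bᶜ}` with `B \ C` a
singleton force, by induction on `B`, a point at which no conjunction holds to be a zero. Since
`{C, B \ C, Bᶜ}` is also the partition of the chain `Bᶜ ⊆ Cᶜ`, matching the sets `B` above the
middle level injectively to sets `C` one level below lets one partition serve both `B` and `Cᶜ`.
About `2 ^ (k - 1)` partitions with three literals each remain.
-/

section Counting

open Finset

variable {α : Type*}

theorem two_mul_card_filter_of_involutive {s : Finset α} {p : α → Prop} [DecidablePred p]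
    {σ : α → α} (hσ : Function.Involutive σ) (hs : ∀ x ∈ s, σ x ∈ s)
    (hp : ∀ x ∈ s, (p (σ x) ↔ ¬ p x)) : 2 * #{x ∈ s | p x} = #s := by
  have heq : #{x ∈ s | p x} = #{x ∈ s | ¬ p x} := by
    refine card_nbij' σ σ ?_ ?_ (fun x _ => hσ x) (fun x _ => hσ x)
    all_goals
      intro x hx
      simp only [coe_filter, Set.mem_ofPred_eq] at hx ⊢
      have := hp x hx.1
      exact ⟨hs x hx.1, by tauto⟩
  rw [← card_filter_add_card_filter_not (s := s) p, ← heq, two_mul]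

variable [Fintype α] [DecidableEq α]

theorem two_mul_card_filter_notMem_of_compl_closed {𝓕 : Finset (Finset α)}
    (h𝓕 : ∀ A ∈ 𝓕, Aᶜ ∈ 𝓕) (a : α) : 2 * #{A ∈ 𝓕 | a ∉ A} = #𝓕 :=
  two_mul_card_filter_of_involutive compl_involutive h𝓕 (by simp)

theorem two_mul_card_filter_mem_iff_mem {a b : α} (hab : a ≠ b) :
    2 * #{A : Finset α | a ∈ A ↔ b ∈ A} = 2 ^ Fintype.card α := by
  rw [two_mul_card_filter_of_involutive (σ := fun A => symmDiff A {a}), card_univ,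
    Fintype.card_finset]
  · exact fun A => symmDiff_symmDiff_cancel_right _ _
  · simp
  · intro A _
    simp only [mem_symmDiff, mem_singleton, hab.symm]
    tauto

theorem card_filter_nonempty_ne_univ_add_two [Nonempty α] :
    #{A : Finset α | A.Nonempty ∧ A ≠ univ} + 2 = 2 ^ Fintype.card α := by
  have hfilter : ({A : Finset α | A.Nonempty ∧ A ≠ univ} : Finset (Finset α)) = {∅, univ}ᶜ := by
    ext A
    simp [nonempty_iff_ne_empty]
  have hpair : #{∅, (univ : Finset α)} = 2 := card_pair univ_nonempty.ne_empty.symm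
  rw [hfilter, ← Fintype.card_finset, ← card_compl_add_card {∅, (univ : Finset α)}, hpair]

theorem sum_card_filter_mem_and_eq (D : Finset (Finset α)) (p : Finset α → α → Prop)
    [∀ K a, Decidable (p K a)] :
    ∑ a, #{K ∈ D | a ∈ K ∧ p K a} = ∑ K ∈ D, #{a ∈ K | p K a} := by
  refine (sum_card_bipartiteAbove_eq_sum_card_bipartiteBelow fun a K => a ∈ K ∧ p K a).trans
    (sum_congr rfl fun K _ => congrArg card ?_)
  ext a
  simp [bipartiteBelow]

end Counting

section PrivateCover

open Finset

variable {Ω Λ : Type*} [DecidableEq Ω] [DecidableEq Λ]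

/-- The points of `A l` that lie in no other set of the block `K`. -/
def privatePart (A : Λ → Finset Ω) (K : Finset Λ) (l : Λ) : Finset Ω :=
  {i ∈ A l | ∀ l' ∈ K, i ∈ A l' → l' = l}

theorem mem_privatePart {A : Λ → Finset Ω} {K : Finset Λ} {l : Λ} {i : Ω} :
    i ∈ privatePart A K l ↔ i ∈ A l ∧ ∀ l' ∈ K, i ∈ A l' → l' = l :=
  mem_filter

theorem privatePart_subset (A : Λ → Finset Ω) (K : Finset Λ) (l : Λ) :
    privatePart A K l ⊆ A l :=
  filter_subset _ _

/-- The number of blocks of `D` that contain the label `l`. -/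
def degree (D : Finset (Finset Λ)) (l : Λ) : ℕ := #{K ∈ D | l ∈ K}

/-- The blocks of `D` in which `l` meets another label of degree one. -/
def linkedBlocks (D : Finset (Finset Λ)) (l : Λ) : Finset (Finset Λ) :=
  {K ∈ D | l ∈ K ∧ ∃ l₁ ∈ K, l₁ ≠ l ∧ degree D l₁ = 1}

/-- The set systems that DNFs give rise to: the labels are the literals, `A l` is the set of zeros
of the function at which `l` is false, and the blocks in `D` are the conjunctions. Each point of
each `A l` is private to `l` in some block. -/
structure IsPrivateCover [Fintype Ω] (A : Λ → Finset Ω) (D : Finset (Finset Λ)) : Prop where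
  cover : ∀ K ∈ D, ∀ i, ∃ l ∈ K, i ∈ A l
  exists_mem_privatePart : ∀ l, ∀ i ∈ A l, ∃ K ∈ D, l ∈ K ∧ i ∈ privatePart A K l
  ne_compl : ∀ K ∈ D, ∀ l ∈ K, ∀ l' ∈ K, A l' ≠ (A l)ᶜ
  ne_univ : ∀ l, A l ≠ univ

variable {A : Λ → Finset Ω} {D : Finset (Finset Λ)} {K : Finset Λ} {l l₁ : Λ}

theorem eq_of_degree_eq_one (hl : degree D l = 1) {K' : Finset Λ} (hK : K ∈ D) (hlK : l ∈ K)
    (hK' : K' ∈ D) (hlK' : l ∈ K') : K' = K :=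
  card_le_one.1 hl.le _ (mem_filter.2 ⟨hK', hlK'⟩) _ (mem_filter.2 ⟨hK, hlK⟩)

theorem sum_degree [Fintype Λ] (D : Finset (Finset Λ)) : ∑ l, degree D l = ∑ K ∈ D, #K := by
  simpa [degree] using sum_card_filter_mem_and_eq D fun _ _ => True

theorem linkedBlocks_subset (D : Finset (Finset Λ)) (l : Λ) :
    linkedBlocks D l ⊆ ({K ∈ D | l ∈ K} : Finset (Finset Λ)) :=
  monotone_filter_right _ fun _ _ h => h.1

namespace IsPrivateCover

variable [Fintype Ω]

theorem one_le_degree (h : IsPrivateCover A D) (hl : (A l).Nonempty) : 1 ≤ degree D l := by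
  obtain ⟨i, hi⟩ := hl
  obtain ⟨K, hK, hlK, -⟩ := h.exists_mem_privatePart l i hi
  exact card_pos.2 ⟨K, mem_filter.2 ⟨hK, hlK⟩⟩

theorem privatePart_eq_of_degree_eq_one (h : IsPrivateCover A D) (hl : degree D l = 1)
    (hK : K ∈ D) (hlK : l ∈ K) : privatePart A K l = A l := by
  refine (privatePart_subset A K l).antisymm fun i hi => ?_
  obtain ⟨K', hK', hlK', hpriv⟩ := h.exists_mem_privatePart l i hi
  rwa [eq_of_degree_eq_one hl hK hlK hK' hlK'] at hpriv

theorem disjoint_of_degree_eq_one (h : IsPrivateCover A D) (hl₁ : degree D l₁ = 1)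
    (hK : K ∈ D) (hl₁K : l₁ ∈ K) (hlK : l ∈ K) (hne : l ≠ l₁) : Disjoint (A l₁) (A l) := by
  rw [← h.privatePart_eq_of_degree_eq_one hl₁ hK hl₁K, disjoint_left]
  exact fun i hi hil => hne ((mem_privatePart.1 hi).2 l hlK hil)

theorem exists_mem_ne_and_ne (h : IsPrivateCover A D) (hl₁ : degree D l₁ = 1)
    (hK : K ∈ D) (hl₁K : l₁ ∈ K) (hlK : l ∈ K) (hne : l ≠ l₁) :
    ∃ l₂ ∈ K, l₂ ≠ l ∧ l₂ ≠ l₁ := by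
  by_contra! hcon
  refine h.ne_compl K hK l₁ hl₁K l hlK (Subset.antisymm ?_ fun i hi => ?_)
  · exact subset_compl_iff_disjoint_left.2 (h.disjoint_of_degree_eq_one hl₁ hK hl₁K hlK hne)
  · obtain ⟨l₂, hl₂, hi₂⟩ := h.cover K hK i
    by_cases hl₂l : l₂ = l
    · exact hl₂l ▸ hi₂
    · exact absurd (hcon l₂ hl₂ hl₂l ▸ hi₂) (mem_compl.1 hi)

theorem two_le_card_erase (h : IsPrivateCover A D) (hl₁ : degree D l₁ = 1) (hK : K ∈ D)
    (hl₁K : l₁ ∈ K) : 2 ≤ #(K.erase l₁) := by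
  obtain ⟨l, hlK, hne⟩ : ∃ l ∈ K, l ≠ l₁ := by
    by_contra! hcon
    refine h.ne_univ l₁ (eq_univ_of_forall fun i => ?_)
    obtain ⟨l, hlK, hi⟩ := h.cover K hK i
    exact hcon l hlK ▸ hi
  obtain ⟨l₂, hl₂K, hl₂l, hl₂l₁⟩ := h.exists_mem_ne_and_ne hl₁ hK hl₁K hlK hne
  exact one_lt_card.2 ⟨l, mem_erase.2 ⟨hne, hlK⟩, l₂, mem_erase.2 ⟨hl₂l₁, hl₂K⟩, hl₂l.symm⟩

variable {m : ℝ}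

theorem card_privatePart_add_le (h : IsPrivateCover A D) (hm : ∀ l, m ≤ #(A l))
    (hl₁ : degree D l₁ = 1) (hK : K ∈ D) (hl₁K : l₁ ∈ K) (hlK : l ∈ K) (hne : l ≠ l₁) :
    #(privatePart A K l) + 2 * m ≤ Fintype.card Ω := by
  obtain ⟨l₂, hl₂K, hl₂l, hl₂l₁⟩ := h.exists_mem_ne_and_ne hl₁ hK hl₁K hlK hne
  have hpriv : Disjoint (privatePart A K l) (A l₁ ∪ A l₂) := by
    rw [disjoint_left]
    intro i hi hi'
    rcases mem_union.1 hi' with h₁ | h₂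
    · exact hne ((mem_privatePart.1 hi).2 l₁ hl₁K h₁).symm
    · exact hl₂l ((mem_privatePart.1 hi).2 l₂ hl₂K h₂)
  have hcard := card_le_univ (privatePart A K l ∪ (A l₁ ∪ A l₂))
  rw [card_union_of_disjoint hpriv,
    card_union_of_disjoint (h.disjoint_of_degree_eq_one hl₁ hK hl₁K hl₂K hl₂l₁)] at hcard
  have hcard' : (#(privatePart A K l) + (#(A l₁) + #(A l₂)) : ℝ) ≤ Fintype.card Ω := by
    exact_mod_cast hcard
  linarith [hm l₁, hm l₂]

theorem eq_of_degree_eq_one_of_mem (h : IsPrivateCover A D) (hm : ∀ l, m ≤ #(A l))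
    (hΩ : Fintype.card Ω < 3 * m) (hK : K ∈ D) (hl : degree D l = 1) (hlK : l ∈ K)
    (hl₁ : degree D l₁ = 1) (hl₁K : l₁ ∈ K) : l = l₁ := by
  by_contra hne
  have hcard := h.card_privatePart_add_le hm hl₁ hK hl₁K hlK hne
  rw [h.privatePart_eq_of_degree_eq_one hl hK hlK] at hcard
  linarith [hm l]

theorem two_mul_card_degree_eq_one_in_block_le (h : IsPrivateCover A D) (hm : ∀ l, m ≤ #(A l))
    (hΩ : Fintype.card Ω < 3 * m) (hK : K ∈ D) :
    2 * #{l ∈ K | degree D l = 1} ≤ #{l ∈ K | ∃ l₁ ∈ K, l₁ ≠ l ∧ degree D l₁ = 1} := by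
  rcases ({l ∈ K | degree D l = 1} : Finset Λ).eq_empty_or_nonempty with hempty | ⟨l₁, hl₁⟩
  · simp [hempty]
  obtain ⟨hl₁K, hl₁⟩ := mem_filter.1 hl₁
  have hone : #{l ∈ K | degree D l = 1} ≤ 1 := card_le_one.2 fun l hl l' hl' =>
    h.eq_of_degree_eq_one_of_mem hm hΩ hK (mem_filter.1 hl).2 (mem_filter.1 hl).1
      (mem_filter.1 hl').2 (mem_filter.1 hl').1
  have hsub : K.erase l₁ ⊆ {l ∈ K | ∃ l₁ ∈ K, l₁ ≠ l ∧ degree D l₁ = 1} := fun l hl =>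
    mem_filter.2 ⟨mem_of_mem_erase hl, l₁, hl₁K, (ne_of_mem_erase hl).symm, hl₁⟩
  have := (h.two_le_card_erase hl₁ hK hl₁K).trans (card_le_card hsub)
  omega

theorem two_mul_card_degree_eq_one_le [Fintype Λ] (h : IsPrivateCover A D)
    (hm : ∀ l, m ≤ #(A l)) (hΩ : Fintype.card Ω < 3 * m) :
    2 * #{l | degree D l = 1} ≤ ∑ l, #(linkedBlocks D l) := by
  have hblocks : #{l | degree D l = 1} = ∑ K ∈ D, #{l ∈ K | degree D l = 1} := by
    rw [← sum_card_filter_mem_and_eq D fun _ l => degree D l = 1, card_filter]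
    refine sum_congr rfl fun l _ => ?_
    split_ifs with hl
    · simp only [hl, and_true]
      exact hl.symm
    · simp [hl]
  calc 2 * #{l | degree D l = 1} = ∑ K ∈ D, 2 * #{l ∈ K | degree D l = 1} := by
        rw [hblocks, mul_sum]
    _ ≤ ∑ K ∈ D, #{l ∈ K | ∃ l₁ ∈ K, l₁ ≠ l ∧ degree D l₁ = 1} :=
        sum_le_sum fun K hK => h.two_mul_card_degree_eq_one_in_block_le hm hΩ hK
    _ = ∑ l, #(linkedBlocks D l) :=
        (sum_card_filter_mem_and_eq D fun K l => ∃ l₁ ∈ K, l₁ ≠ l ∧ degree D l₁ = 1).symm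

theorem add_card_linkedBlocks_mul_le (h : IsPrivateCover A D) (hm : ∀ l, m ≤ #(A l))
    (hm₀ : 0 ≤ m) (l : Λ) :
    m + #(linkedBlocks D l) * (3 * m - Fintype.card Ω) ≤ degree D l * m := by
  have hsum : ∑ K ∈ linkedBlocks D l, (#(privatePart A K l) : ℝ) ≤
      #(linkedBlocks D l) * (Fintype.card Ω - 2 * m) := by
    rw [← nsmul_eq_mul]
    refine sum_le_card_nsmul _ _ _ fun K hK => ?_
    obtain ⟨hKD, hlK, l₁, hl₁K, hne, hl₁⟩ := mem_filter.1 hK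
    linarith [h.card_privatePart_add_le hm hl₁ hKD hl₁K hlK hne.symm]
  have hsum₀ : 0 ≤ ∑ K ∈ linkedBlocks D l, (#(privatePart A K l) : ℝ) := by positivity
  rcases (card_le_card (linkedBlocks_subset D l)).lt_or_eq with hlt | heq
  · have hlt' : (#(linkedBlocks D l) + 1 : ℝ) ≤ degree D l := by exact_mod_cast hlt
    linarith [mul_le_mul_of_nonneg_right hlt' hm₀]
  · have hall := eq_of_subset_of_card_le (linkedBlocks_subset D l) heq.ge
    have hcover : A l ⊆ (linkedBlocks D l).biUnion fun K => privatePart A K l := by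
      intro i hi
      obtain ⟨K, hK, hlK, hpriv⟩ := h.exists_mem_privatePart l i hi
      exact mem_biUnion.2 ⟨K, hall ▸ mem_filter.2 ⟨hK, hlK⟩, hpriv⟩
    have hcard : #(A l) ≤ ∑ K ∈ linkedBlocks D l, (#(privatePart A K l) : ℝ) := by
      exact_mod_cast (card_le_card hcover).trans card_biUnion_le
    rw [degree, ← heq]
    linarith [hm l]

theorem two_mul_card_le_sum_degree_add [Fintype Λ] (h : IsPrivateCover A D)
    (hA : ∀ l, (A l).Nonempty) :
    2 * Fintype.card Λ ≤ ∑ l, degree D l + #{l | degree D l = 1} := by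
  rw [card_filter, ← sum_add_distrib, mul_comm, ← smul_eq_mul, ← card_univ]
  refine card_nsmul_le_sum _ _ _ fun l _ => ?_
  have := h.one_le_degree (hA l)
  split_ifs <;> omega

theorem mul_card_le_mul_sum_card [Fintype Λ] (h : IsPrivateCover A D) (hm : ∀ l, m ≤ #(A l))
    (hΩ : Fintype.card Ω < 3 * m) :
    (13 * m - 4 * Fintype.card Ω) * Fintype.card Λ ≤
      (7 * m - 2 * Fintype.card Ω) * (∑ K ∈ D, #K : ℕ) := by
  have hm₀ : 0 < m := by linarith [Nat.cast_nonneg (α := ℝ) (Fintype.card Ω)]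
  have hA (l : Λ) : (A l).Nonempty := card_pos.1 (by exact_mod_cast hm₀.trans_le (hm l))
  have hlinked : (2 * #{l | degree D l = 1} : ℝ) ≤ ∑ l, (#(linkedBlocks D l) : ℝ) := by
    exact_mod_cast h.two_mul_card_degree_eq_one_le hm hΩ
  have hdegree : (2 * Fintype.card Λ : ℝ) ≤ (∑ K ∈ D, #K : ℕ) + #{l | degree D l = 1} := by
    rw [← sum_degree]
    exact_mod_cast h.two_mul_card_le_sum_degree_add hA
  have hlabels : m * Fintype.card Λ +
      (∑ l, (#(linkedBlocks D l) : ℝ)) * (3 * m - Fintype.card Ω) ≤ (∑ K ∈ D, #K : ℕ) * m := by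
    have := sum_le_sum fun l (_ : l ∈ univ) => h.add_card_linkedBlocks_mul_le hm hm₀.le l
    rw [sum_add_distrib, ← sum_mul, ← sum_mul, sum_const, nsmul_eq_mul, card_univ] at this
    rw [← sum_degree]
    push_cast
    linarith
  have hlinked_ge : 2 * (2 * Fintype.card Λ - (∑ K ∈ D, #K : ℕ)) ≤
      ∑ l, (#(linkedBlocks D l) : ℝ) := by linarith
  have := mul_le_mul_of_nonneg_right hlinked_ge (sub_nonneg.2 hΩ.le)
  linarith

end IsPrivateCover

end PrivateCover

section Literals

open Finset

variable {k n : ℕ}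

/-- The negation of a literal. -/
def Lit.neg (l : Lit n) : Lit n := (l.1, !l.2)

theorem Conj.IsElementary.ne_neg {K : Conj n} (hK : K.IsElementary) {l l' : Lit n} (hl : l ∈ K)
    (hl' : l' ∈ K) : l' ≠ l.neg := by
  rintro rfl
  obtain ⟨j, _ | _⟩ := l
  · exact hK j ⟨hl', hl⟩
  · exact hK j ⟨hl, hl'⟩

theorem exists_realizes_rank_eq_minRank (f : BoolFn n) :
    ∃ D : DNF n, D.Realizes f ∧ D.rank = minRank f :=
  have ⟨D, hD⟩ := exists_dnf_realizes f
  Nat.sInf_mem (s := {r : ℕ | ∃ D : DNF n, D.Realizes f ∧ D.rank = r}) ⟨_, D, hD, rfl⟩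

theorem minRank_le {f : BoolFn n} {D : DNF n} (hD : D.Realizes f) : minRank f ≤ D.rank :=
  Nat.sInf_le ⟨D, hD, rfl⟩

/-- The indices of the rows of `M` at which the literal `l` is false. -/
def falseRows (M : Matrix (Fin k) (Fin n) Bool) (l : Lit n) : Finset (Fin k) :=
  {i | M i l.1 ≠ l.2}

variable {M : Matrix (Fin k) (Fin n) Bool}

theorem mem_falseRows {l : Lit n} {i : Fin k} : i ∈ falseRows M l ↔ M i l.1 ≠ l.2 := by
  simp [falseRows]

theorem falseRows_neg (l : Lit n) : falseRows M l.neg = (falseRows M l)ᶜ := by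
  ext i
  simp [mem_falseRows, Lit.neg]

theorem holds_row_iff {K : Conj n} {i : Fin k} :
    K.Holds (M i) ↔ ∀ l ∈ K, i ∉ falseRows M l := by
  simp [Conj.Holds, mem_falseRows]

theorem weight_le_card_falseRows (M : Matrix (Fin k) (Fin n) Bool) (l : Lit n) :
    weight (fun i => M i l.1) ≤ #(falseRows M l) := by
  obtain ⟨j, _ | _⟩ := l <;> simp [weight, falseRows]

theorem weight_eq_min_card_falseRows (M : Matrix (Fin k) (Fin n) Bool) (j : Fin n) :
    weight (fun i => M i j) = min #(falseRows M (j, false)) #(falseRows M (j, true)) := by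
  simp [weight, falseRows]

namespace HasReducedColumns

theorem falseRows_injective (hM : HasReducedColumns M) : Function.Injective (falseRows M) := by
  rintro ⟨j, σ⟩ ⟨j', σ'⟩ heq
  have hrow (i : Fin k) : M i j = σ ↔ M i j' = σ' := by
    simpa [mem_falseRows] using (Finset.ext_iff.1 heq i).not
  by_cases hσ : σ = σ'
  · subst hσ
    by_cases hj : j = j'
    · rw [hj]
    obtain ⟨i, hi⟩ := hM.distinct j j' hj
    have := hrow i
    cases σ <;> simp_all
  · obtain ⟨i, hi⟩ := hM.not_negation j j'
    have := hrow i
    cases σ <;> cases σ' <;> simp_all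

theorem falseRows_nonempty (hM : HasReducedColumns M) (l : Lit n) : (falseRows M l).Nonempty := by
  obtain ⟨j, _ | _⟩ := l
  · obtain ⟨i, hi⟩ := hM.exists_one j
    exact ⟨i, by simp [mem_falseRows, hi]⟩
  · obtain ⟨i, hi⟩ := hM.exists_zero j
    exact ⟨i, by simp [mem_falseRows, hi]⟩

theorem falseRows_ne_univ (hM : HasReducedColumns M) (l : Lit n) : falseRows M l ≠ univ := by
  rw [ne_eq, ← compl_eq_empty_iff, ← falseRows_neg]
  exact (hM.falseRows_nonempty l.neg).ne_empty

theorem falseRows_ne_compl (hM : HasReducedColumns M) {K : Conj n} (hK : K.IsElementary)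
    {l l' : Lit n} (hl : l ∈ K) (hl' : l' ∈ K) : falseRows M l' ≠ (falseRows M l)ᶜ := by
  rw [← falseRows_neg]
  exact hM.falseRows_injective.ne (hK.ne_neg hl hl')

theorem image_falseRows_subset (hM : HasReducedColumns M) :
    univ.image (falseRows M) ⊆ ({A | A.Nonempty ∧ A ≠ univ} : Finset (Finset (Fin k))) := by
  simp [image_subset_iff, hM.falseRows_nonempty, hM.falseRows_ne_univ]

theorem card_image_falseRows (hM : HasReducedColumns M) : #(univ.image (falseRows M)) = 2 * n := by
  rw [card_image_of_injective _ hM.falseRows_injective, card_univ, Fintype.card_prod,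
    Fintype.card_fin, Fintype.card_bool, mul_comm]

theorem le_two_pow_sub_one (hM : HasReducedColumns M) (hk : 1 ≤ k) : n ≤ 2 ^ (k - 1) - 1 := by
  have : Nonempty (Fin k) := ⟨⟨0, hk⟩⟩
  have hcard := card_filter_nonempty_ne_univ_add_two (α := Fin k)
  have hle := card_le_card hM.image_falseRows_subset
  rw [hM.card_image_falseRows] at hle
  rw [Fintype.card_fin, ← Nat.two_pow_pred_mul_two hk] at hcard
  omega

theorem exists_falseRows_eq (hM : HasReducedColumns M) (hn : 2 * n + 2 = 2 ^ k)
    {A : Finset (Fin k)} (hA : A.Nonempty) (hA' : A ≠ univ) : ∃ l, falseRows M l = A := by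
  have : Nonempty (Fin k) := hA.to_type
  have hcard := card_filter_nonempty_ne_univ_add_two (α := Fin k)
  have himage := eq_of_subset_of_card_le hM.image_falseRows_subset <| by
    rw [hM.card_image_falseRows]
    rw [Fintype.card_fin] at hcard
    omega
  have hmem : A ∈ univ.image (falseRows M) := himage ▸ mem_filter.2 ⟨mem_univ A, hA, hA'⟩
  simpa using hmem

theorem four_mul_le_add_four_mul_hammingDist (hM : HasReducedColumns M) {i i' : Fin k}
    (hne : i ≠ i') : 4 * n ≤ 2 ^ k + 4 * hammingDist (M i) (M i') := by
  have hagree : #{j | M i j = M i' j} + hammingDist (M i) (M i') = n := by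
    simpa [hammingDist] using
      card_filter_add_card_filter_not (s := univ) fun j => M i j = M i' j
  have hle : #(({j | M i j = M i' j} : Finset (Fin n)) ×ˢ (univ : Finset Bool)) ≤
      #{A : Finset (Fin k) | i ∈ A ↔ i' ∈ A} := by
    refine card_le_card_of_injOn (falseRows M) (fun l hl => ?_) hM.falseRows_injective.injOn
    simp only [coe_product, coe_filter, mem_univ, true_and, coe_univ, Set.mem_prod,
      Set.mem_ofPred_eq] at hl
    simp [mem_falseRows, hl.1]
  rw [card_product, card_univ, Fintype.card_bool] at hle
  have := two_mul_card_filter_mem_iff_mem hne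
  rw [Fintype.card_fin] at this
  omega

end HasReducedColumns

variable {f : BoolFn n}

theorem IsZeroMatrix.eq_false (hM : IsZeroMatrix M f) (i : Fin k) : f (M i) = false :=
  (hM.2 _).2 ⟨i, rfl⟩

theorem IsZeroMatrix.update_eq_true (hM : IsZeroMatrix M f)
    (hdist : ∀ i i', i ≠ i' → 2 ≤ hammingDist (M i) (M i')) {i : Fin k} {l : Lit n}
    (hi : i ∈ falseRows M l) : f (Function.update (M i) l.1 l.2) = true := by
  by_contra hfalse
  obtain ⟨i', hi'⟩ := (hM.2 _).1 (Bool.eq_false_iff.2 hfalse)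
  have hne : i ≠ i' := by
    rintro rfl
    refine mem_falseRows.1 hi ?_
    rw [hi', Function.update_self]
  have hle : hammingDist (M i) (M i') ≤ #{l.1} := by
    refine card_le_card fun j hj => mem_singleton.2 ?_
    by_contra hjl
    rw [mem_filter, hi', Function.update_of_ne hjl] at hj
    exact hj.2 rfl
  have := hdist i i' hne
  simp only [card_singleton] at hle
  omega

theorem IsZeroMatrix.isPrivateCover_falseRows (hM : IsZeroMatrix M f)
    (hred : HasReducedColumns M) (hdist : ∀ i i', i ≠ i' → 2 ≤ hammingDist (M i) (M i'))
    {D : DNF n} (hD : D.Realizes f) : IsPrivateCover (falseRows M) D where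
  cover K hK i := by
    by_contra! hcon
    exact absurd ((hD.2 _).2 ⟨K, hK, holds_row_iff.2 hcon⟩) (by simp [hM.eq_false i])
  exists_mem_privatePart l i hi := by
    obtain ⟨K, hK, hholds⟩ := (hD.2 _).1 (hM.update_eq_true hdist hi)
    have hpriv (l' : Lit n) (hl' : l' ∈ K) (hi' : i ∈ falseRows M l') : l' = l := by
      have hval := hholds l' hl'
      by_cases hj : l'.1 = l.1
      · rw [hj, Function.update_self] at hval
        exact Prod.ext hj hval.symm
      · rw [Function.update_of_ne hj] at hval
        exact absurd hval (mem_falseRows.1 hi')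
    have hlK : l ∈ K := by
      by_contra hlK
      have hrow : K.Holds (M i) := holds_row_iff.2 fun l' hl' hi' => hlK (hpriv l' hl' hi' ▸ hl')
      exact absurd ((hD.2 _).2 ⟨K, hK, hrow⟩) (by simp [hM.eq_false i])
    exact ⟨K, hK, hlK, mem_privatePart.2 ⟨hi, hpriv⟩⟩
  ne_compl K hK _ hl _ hl' := hred.falseRows_ne_compl (hD.1 K hK) hl hl'
  ne_univ := hred.falseRows_ne_univ

theorem IsZeroMatrix.mul_le_mul_minRank (hM : IsZeroMatrix M f) (hred : HasReducedColumns M)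
    (hdist : ∀ i i', i ≠ i' → 2 ≤ hammingDist (M i) (M i')) {m : ℝ}
    (hm : ∀ j, m ≤ weight fun i => M i j) (hkm : k < 3 * m) :
    (13 * m - 4 * k) * (2 * n) ≤ (7 * m - 2 * k) * minRank f := by
  obtain ⟨D, hD, hrank⟩ := exists_realizes_rank_eq_minRank f
  have := (hM.isPrivateCover_falseRows hred hdist hD).mul_card_le_mul_sum_card (m := m)
    (fun l => (hm l.1).trans (by exact_mod_cast weight_le_card_falseRows M l)) (by simpa using hkm)
  rw [Fintype.card_prod, Fintype.card_fin, Fintype.card_fin, Fintype.card_bool] at this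
  rw [← hrank, DNF.rank, mul_comm 2 (n : ℝ)]
  exact_mod_cast this

end Literals

section Restriction

open Finset

variable {k n m : ℕ}

/-- The literals of `K` in the variables of the range of `e`, renamed along `e`. -/
def Conj.comap (e : Fin n → Fin m) (K : Conj m) : Conj n :=
  univ.filter fun l => (e l.1, l.2) ∈ K

theorem Conj.mem_comap {e : Fin n → Fin m} {K : Conj m} {l : Lit n} :
    l ∈ K.comap e ↔ (e l.1, l.2) ∈ K := by
  simp [Conj.comap]

theorem Conj.card_comap_le {e : Fin n → Fin m} (he : Function.Injective e) (K : Conj m) :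
    #(K.comap e) ≤ #K :=
  card_le_card_of_injOn (fun l => (e l.1, l.2)) (fun _ hl => Conj.mem_comap.1 hl)
    (he.prodMap Function.injective_id).injOn

theorem Conj.holds_comap_iff {e : Fin n → Fin m} (he : Function.Injective e) {c : Fin m → Bool}
    {K : Conj m} (hK : ∀ l ∈ K, l.1 ∉ Set.range e → c l.1 = l.2) {x : Fin n → Bool} :
    (K.comap e).Holds x ↔ K.Holds (Function.extend e x c) := by
  refine ⟨fun h l hl => ?_, fun h l hl => ?_⟩
  · by_cases hrange : l.1 ∈ Set.range e
    · obtain ⟨j, hj⟩ := hrange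
      rw [← hj, he.extend_apply]
      exact h (j, l.2) (Conj.mem_comap.2 (by rwa [hj]))
    · rw [Function.extend_apply' _ _ _ hrange]
      exact hK l hl hrange
  · rw [← h _ (Conj.mem_comap.1 hl), he.extend_apply]

open Classical in
/-- The DNF obtained from `D` by setting the variables outside the range of `e` to the values `c`
and renaming the others along `e`. -/
noncomputable def DNF.restrict (e : Fin n → Fin m) (c : Fin m → Bool) (D : DNF m) : DNF n :=
  {K ∈ D | ∀ l ∈ K, l.1 ∉ Set.range e → c l.1 = l.2}.image (Conj.comap e)

theorem DNF.rank_restrict_le {e : Fin n → Fin m} (he : Function.Injective e) (c : Fin m → Bool)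
    (D : DNF m) : (D.restrict e c).rank ≤ D.rank := by
  classical
  calc (D.restrict e c).rank
      ≤ ∑ K ∈ D with ∀ l ∈ K, l.1 ∉ Set.range e → c l.1 = l.2, #(K.comap e) :=
        sum_image_le_of_nonneg fun _ _ => Nat.zero_le _
    _ ≤ ∑ K ∈ D with ∀ l ∈ K, l.1 ∉ Set.range e → c l.1 = l.2, #K :=
        sum_le_sum fun K _ => K.card_comap_le he
    _ ≤ D.rank := sum_le_sum_of_subset (filter_subset _ _)

theorem DNF.Realizes.restrict {e : Fin n → Fin m} (he : Function.Injective e) (c : Fin m → Bool)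
    {D : DNF m} {g : BoolFn m} (hD : D.Realizes g) :
    (D.restrict e c).Realizes fun x => g (Function.extend e x c) := by
  classical
  refine ⟨fun K' hK' j hj => ?_, fun x => (hD.2 _).trans ⟨?_, ?_⟩⟩
  · obtain ⟨K, hK, rfl⟩ := mem_image.1 hK'
    exact hD.1 K (mem_filter.1 hK).1 (e j) ⟨Conj.mem_comap.1 hj.1, Conj.mem_comap.1 hj.2⟩
  · rintro ⟨K, hK, hx⟩
    have hconst : ∀ l ∈ K, l.1 ∉ Set.range e → c l.1 = l.2 := fun l hl hrange => by
      rw [← hx l hl, Function.extend_apply' _ _ _ hrange]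
    exact ⟨_, mem_image_of_mem _ (mem_filter.2 ⟨hK, hconst⟩), (Conj.holds_comap_iff he hconst).2 hx⟩
  · rintro ⟨K', hK', hx⟩
    obtain ⟨K, hK, rfl⟩ := mem_image.1 hK'
    obtain ⟨hKD, hconst⟩ := mem_filter.1 hK
    exact ⟨K, hKD, (Conj.holds_comap_iff he hconst).1 hx⟩

theorem minRank_extend_le {e : Fin n → Fin m} (he : Function.Injective e) (c : Fin m → Bool)
    (g : BoolFn m) : minRank (fun x => g (Function.extend e x c)) ≤ minRank g := by
  obtain ⟨D, hD, hrank⟩ := exists_realizes_rank_eq_minRank g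
  exact (minRank_le (hD.restrict he c)).trans ((D.rank_restrict_le he c).trans_eq hrank)

variable {M : Matrix (Fin k) (Fin n) Bool} {f : BoolFn n}

theorem exists_isZeroMatrix (hM : Function.Injective fun i => M i) : ∃ f, IsZeroMatrix M f :=
  ⟨fun x => decide (x ∉ univ.image fun i => M i), hM, by simp⟩

theorem IsZeroMatrix.mem_zeroClass (hM : IsZeroMatrix M f) : f ∈ zeroClass k n := by
  have hzeros : ({x | f x = false} : Finset (Fin n → Bool)) = univ.image fun i => M i := by
    ext x
    simp [hM.2 x]
  rw [zeroClass, Set.mem_ofPred_eq, hzeros, card_image_of_injective _ hM.1, card_univ,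
    Fintype.card_fin]

theorem IsZeroMatrix.exists_mem_zeroClass (hM : IsZeroMatrix M f) (hnm : n ≤ m) :
    ∃ g ∈ zeroClass k m, minRank f ≤ minRank g := by
  let ext (x : Fin n → Bool) : Fin m → Bool := Function.extend (Fin.castLE hnm) x fun _ => false
  have hext : Function.Injective ext := fun x y hxy => funext fun j => by
    simpa [ext, (Fin.castLE_injective hnm).extend_apply] using congrFun hxy (Fin.castLE hnm j)
  obtain ⟨g, hg⟩ := exists_isZeroMatrix (M := fun i => ext (M i)) (hext.comp hM.1)
  have hgf : (fun x => g (ext x)) = f := by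
    funext x
    refine Bool.eq_iff_iff.2 (not_iff_not.1 ?_)
    rw [Bool.not_eq_true, Bool.not_eq_true, hg.2, hM.2]
    simp only [hext.eq_iff]
  exact ⟨g, hg.mem_zeroClass, hgf ▸ minRank_extend_le (Fin.castLE_injective hnm) _ g⟩

end Restriction

section Columns

open Finset

variable {k n : ℕ}

/-- The matrix whose columns are the characteristic vectors of the sets `C j`. -/
def incidenceMatrix (C : Fin n → Finset (Fin k)) : Matrix (Fin k) (Fin n) Bool :=
  fun i j => decide (i ∈ C j)

theorem falseRows_incidenceMatrix_false (C : Fin n → Finset (Fin k)) (j : Fin n) :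
    falseRows (incidenceMatrix C) (j, false) = C j := by
  ext i
  simp [mem_falseRows, incidenceMatrix]

theorem falseRows_incidenceMatrix_true (C : Fin n → Finset (Fin k)) (j : Fin n) :
    falseRows (incidenceMatrix C) (j, true) = (C j)ᶜ := by
  ext i
  simp [mem_falseRows, incidenceMatrix]

theorem weight_incidenceMatrix (C : Fin n → Finset (Fin k)) (j : Fin n) :
    weight (fun i => incidenceMatrix C i j) = min #(C j) #(C j)ᶜ := by
  rw [weight_eq_min_card_falseRows, falseRows_incidenceMatrix_false,
    falseRows_incidenceMatrix_true]

theorem hasReducedColumns_incidenceMatrix {C : Fin n → Finset (Fin k)}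
    (hC : Function.Injective C) (hne : ∀ j, (C j).Nonempty) {i₀ : Fin k} (hi₀ : ∀ j, i₀ ∉ C j) :
    HasReducedColumns (incidenceMatrix C) where
  exists_one j := (hne j).imp fun i hi => by simpa [incidenceMatrix] using hi
  exists_zero j := ⟨i₀, by simpa [incidenceMatrix] using hi₀ j⟩
  distinct j j' hjj' := by
    by_contra! hcon
    exact hjj' (hC (Finset.ext fun i => by simpa [incidenceMatrix] using hcon i))
  not_negation j j' := ⟨i₀, by simp [incidenceMatrix, hi₀]⟩

/-- One member of each pair `A`, `Aᶜ` of nonempty members of `𝓕`, namely the one that avoids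
`i₀`. -/
def representatives (𝓕 : Finset (Finset (Fin k))) (i₀ : Fin k) : Finset (Finset (Fin k)) :=
  {A ∈ 𝓕 | i₀ ∉ A}.erase ∅

variable {𝓕 : Finset (Finset (Fin k))}

theorem card_le_two_mul_card_representatives_add_one (h𝓕 : ∀ A ∈ 𝓕, Aᶜ ∈ 𝓕) (i₀ : Fin k) :
    #𝓕 ≤ 2 * (#(representatives 𝓕 i₀) + 1) := by
  rw [← two_mul_card_filter_notMem_of_compl_closed h𝓕 i₀]
  exact Nat.mul_le_mul_left 2 (Nat.sub_le_iff_le_add.1 pred_card_le_card_erase)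

theorem card_representatives_univ (i₀ : Fin k) :
    #(representatives univ i₀) = 2 ^ (k - 1) - 1 := by
  have hcard := two_mul_card_filter_notMem_of_compl_closed (𝓕 := univ) (by simp) i₀
  rw [card_univ, Fintype.card_finset, Fintype.card_fin,
    ← Nat.two_pow_pred_mul_two (Fin.pos i₀)] at hcard
  rw [representatives, card_erase_of_mem (by simp)]
  omega

theorem exists_injective_hasReducedColumns (h𝓕 : ∀ A ∈ 𝓕, Aᶜ ∈ 𝓕)
    (hsep : ∀ i i', i ≠ i' → ∃ A ∈ 𝓕, i ∈ A ∧ i' ∉ A) {i₀ : Fin k}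
    (hn : #(representatives 𝓕 i₀) = n) :
    ∃ C : Fin n → Finset (Fin k), (∀ j, C j ∈ 𝓕) ∧
      (Function.Injective fun i => incidenceMatrix C i) ∧
      HasReducedColumns (incidenceMatrix C) := by
  let e := equivFinOfCardEq hn
  have hmem (j : Fin n) : ((e.symm j).1 ≠ ∅) ∧ (e.symm j).1 ∈ 𝓕 ∧ i₀ ∉ (e.symm j).1 := by
    simpa only [representatives, mem_erase, mem_filter] using (e.symm j).2
  refine ⟨fun j => (e.symm j).1, fun j => (hmem j).2.1, fun i i' hrows => ?_,
    hasReducedColumns_incidenceMatrix (Subtype.val_injective.comp e.symm.injective)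
      (fun j => nonempty_iff_ne_empty.2 (hmem j).1) fun j => (hmem j).2.2⟩
  by_contra hne
  obtain ⟨A, hA, hA₀, hiff⟩ : ∃ A ∈ 𝓕, i₀ ∉ A ∧ ¬ (i ∈ A ↔ i' ∈ A) := by
    obtain ⟨A, hA, hi, hi'⟩ := hsep i i' hne
    by_cases hA₀ : i₀ ∈ A
    · exact ⟨Aᶜ, h𝓕 A hA, by simpa using hA₀, by simp [hi, hi']⟩
    · exact ⟨A, hA, hA₀, by simp [hi, hi']⟩
  have hA' : A ∈ representatives 𝓕 i₀ :=
    mem_erase.2 ⟨by rintro rfl; simp at hiff, mem_filter.2 ⟨hA, hA₀⟩⟩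
  exact hiff (by simpa [incidenceMatrix] using congrFun hrows (e ⟨A, hA'⟩))

theorem exists_isCompleteFn (hk : 1 ≤ k) : ∃ φ : BoolFn (2 ^ (k - 1) - 1), IsCompleteFn k φ := by
  obtain ⟨C, -, hrows, hred⟩ := exists_injective_hasReducedColumns (𝓕 := univ) (by simp)
    (fun i i' hne => ⟨{i}, mem_univ _, by simp [hne.symm]⟩)
    (card_representatives_univ (⟨0, hk⟩ : Fin k))
  obtain ⟨φ, hφ⟩ := exists_isZeroMatrix hrows
  exact ⟨φ, _, hφ, hred⟩

end Columns

section BalancedSets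

open Finset

theorem card_filter_card_lt_le {α : Type*} [Fintype α] {s : ℝ} (hs : 0 ≤ s) :
    (#{A : Finset α | (#A : ℝ) < Fintype.card α / 2 - s} : ℝ) ≤
      2 ^ Fintype.card α * Real.exp (-(2 * s ^ 2 / Fintype.card α)) := by
  set N := Fintype.card α with hN
  set t : ℝ := 2 * s / N with ht
  have : 0 ≤ t := by positivity
  have hterm (A : Finset α) : Real.exp (-t) ^ #A * Real.exp t ^ (N - #A) =
      Real.exp (t * (N - 2 * #A)) := by
    rw [← Real.exp_nat_mul, ← Real.exp_nat_mul, ← Real.exp_add, Nat.cast_sub A.card_le_univ, ← hN]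
    ring_nf
  have hsum : ∑ A : Finset α, Real.exp (t * (N - 2 * #A)) = (2 * Real.cosh t) ^ N := by
    simp_rw [← hterm, hN, Fintype.sum_pow_mul_eq_add_pow, Real.cosh_eq]
    ring
  have hmarkov : #{A : Finset α | (#A : ℝ) < N / 2 - s} * Real.exp (t * (2 * s)) ≤
      (2 * Real.cosh t) ^ N := by
    rw [← hsum, ← nsmul_eq_mul]
    refine (card_nsmul_le_sum _ _ _ fun A hA => ?_).trans
      (sum_le_sum_of_subset_of_nonneg (filter_subset _ _) fun _ _ _ => (Real.exp_pos _).le)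
    have := (mem_filter.1 hA).2
    gcongr
    linarith
  have hcosh : (2 * Real.cosh t) ^ N ≤ 2 ^ N * Real.exp (N * (t ^ 2 / 2)) := by
    rw [mul_pow, Real.exp_nat_mul]
    gcongr
    exact Real.cosh_le_exp_half_sq t
  have hexponent : (N : ℝ) * (t ^ 2 / 2) = -(2 * s ^ 2 / N) + t * (2 * s) := by
    rcases eq_or_ne (N : ℝ) 0 with hN₀ | hN₀
    · simp [ht, hN₀]
    · rw [ht]
      field_simp
      ring
  rw [hexponent, Real.exp_add, ← mul_assoc] at hcosh
  exact le_of_mul_le_mul_right (hmarkov.trans hcosh) (Real.exp_pos _)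

/-- The sets that, like their complements, have at least `|α| / 2 - s` elements. -/
noncomputable def balancedSets (α : Type*) [Fintype α] [DecidableEq α] (s : ℝ) :
    Finset (Finset α) :=
  {A | (Fintype.card α : ℝ) / 2 - s ≤ #A ∧ (Fintype.card α : ℝ) / 2 - s ≤ #Aᶜ}

variable {α : Type*} [Fintype α] [DecidableEq α] {s : ℝ} {A : Finset α}

theorem mem_balancedSets : A ∈ balancedSets α s ↔
    (Fintype.card α : ℝ) / 2 - s ≤ #A ∧ (Fintype.card α : ℝ) / 2 - s ≤ #Aᶜ := by
  simp [balancedSets]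

theorem compl_mem_balancedSets (hA : A ∈ balancedSets α s) : Aᶜ ∈ balancedSets α s := by
  rw [mem_balancedSets, compl_compl]
  exact (mem_balancedSets.1 hA).symm

theorem two_pow_sub_le_card_balancedSets (hs : 0 ≤ s) :
    (2 : ℝ) ^ Fintype.card α - 2 * (2 ^ Fintype.card α *
      Real.exp (-(2 * s ^ 2 / Fintype.card α))) ≤ #(balancedSets α s) := by
  set small : Finset (Finset α) := {A | (#A : ℝ) < Fintype.card α / 2 - s} with hsmall
  have hsub : (balancedSets α s)ᶜ ⊆ small ∪ small.image compl := fun A hA => by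
    rw [mem_compl, mem_balancedSets, not_and_or, not_le, not_le] at hA
    simpa [hsmall, compl_eq_comm, eq_comm] using hA
  have hcompl : #(balancedSets α s)ᶜ ≤ 2 * #small := by
    have := (card_le_card hsub).trans (card_union_le _ _)
    have := card_image_le (s := small) (f := compl)
    omega
  have htotal : (#(balancedSets α s) + #(balancedSets α s)ᶜ : ℝ) = 2 ^ Fintype.card α := by
    rw [← Nat.cast_add, card_add_card_compl, Fintype.card_finset, Nat.cast_pow, Nat.cast_ofNat]
  have hcompl' : (#(balancedSets α s)ᶜ : ℝ) ≤ 2 * #small := by exact_mod_cast hcompl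
  linarith [card_filter_card_lt_le (α := α) hs]

theorem exists_mem_balancedSets_separating (hs : 1 / 2 ≤ s) {a b : α} (hab : a ≠ b) :
    ∃ A ∈ balancedSets α s, a ∈ A ∧ b ∉ A := by
  have hcard : 2 ≤ Fintype.card α := Fintype.one_lt_card_iff.2 ⟨a, b, hab⟩
  obtain ⟨A, haA, hAb, hA⟩ := exists_subsuperset_card_eq (s := {a}) (t := {b}ᶜ)
    (n := Fintype.card α / 2) (by simpa using hab.symm) (by rw [card_singleton]; omega)
    (by rw [card_compl, card_singleton]; omega)
  have hAc : #A + #Aᶜ = Fintype.card α := card_add_card_compl A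
  have hA₁ : Fintype.card α ≤ 2 * #A + 1 := by omega
  have hA₂ : Fintype.card α ≤ 2 * #Aᶜ + 1 := by omega
  have hA₁' : (Fintype.card α : ℝ) ≤ 2 * #A + 1 := by exact_mod_cast hA₁
  have hA₂' : (Fintype.card α : ℝ) ≤ 2 * #Aᶜ + 1 := by exact_mod_cast hA₂
  exact ⟨A, mem_balancedSets.2 ⟨by linarith, by linarith⟩, by simpa using haA,
    fun hb => by simpa using hAb hb⟩

end BalancedSets

section Extremal

open Finset

variable {k : ℕ}

theorem half_le_sqrt_mul_log (hk : 2 ≤ k) : 1 / 2 ≤ √((k : ℝ) * Real.log k) := by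
  have hk' : (2 : ℝ) ≤ k := by exact_mod_cast hk
  have hlog : Real.log 2 ≤ Real.log k := Real.log_le_log (by norm_num) hk'
  refine Real.le_sqrt_of_sq_le ?_
  nlinarith [Real.log_two_gt_d9]

theorem two_pow_mul_le_card_balancedSets (hk : 1 ≤ k) :
    2 ^ k * (1 - 2 / (k : ℝ) ^ 2) ≤ #(balancedSets (Fin k) √((k : ℝ) * Real.log k)) := by
  have hk₀ : (0 : ℝ) < k := by exact_mod_cast hk
  have hexp : Real.exp (-(2 * √((k : ℝ) * Real.log k) ^ 2 / k)) = 1 / (k : ℝ) ^ 2 := by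
    rw [Real.sq_sqrt (mul_nonneg hk₀.le (Real.log_natCast_nonneg k)), ← Real.exp_log hk₀,
      ← Real.exp_nat_mul, one_div, ← Real.exp_neg, Real.exp_log hk₀]
    congr 1
    field_simp
    push_cast
    ring
  have := two_pow_sub_le_card_balancedSets (α := Fin k) (Real.sqrt_nonneg (k * Real.log k))
  rw [Fintype.card_fin, hexp] at this
  exact this.trans_eq' (by ring)

theorem two_pow_mul_one_sub_two_div_le {N n : ℕ} (hk : 1 ≤ k)
    (hN : 2 ^ k * (1 - 2 / (k : ℝ) ^ 2) ≤ N) (hn : N ≤ 2 * (n + 1)) :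
    2 ^ (k - 1) * (1 - 2 / (k : ℝ)) ≤ n := by
  obtain rfl | hk₂ := hk.eq_or_lt
  · norm_num
    linarith [Nat.cast_nonneg (α := ℝ) n]
  have hk' : (2 : ℝ) ≤ k := by exact_mod_cast hk₂
  have hn' : (N : ℝ) ≤ 2 * (n + 1) := by exact_mod_cast hn
  have hpow : (k : ℝ) ≤ 2 ^ (k - 1) := by
    exact_mod_cast Nat.le_of_pred_lt (Nat.lt_two_pow_self (n := k - 1))
  have hslack : 1 ≤ (2 : ℝ) ^ (k - 1) * (2 / k - 2 / (k : ℝ) ^ 2) := by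
    have hfrac : 1 / (k : ℝ) ≤ 2 / k - 2 / (k : ℝ) ^ 2 := by
      have : 2 / k - 2 / (k : ℝ) ^ 2 - 1 / k = (k - 2) / (k : ℝ) ^ 2 := by
        field_simp
        ring
      linarith [div_nonneg (sub_nonneg.2 hk') (sq_nonneg (k : ℝ))]
    calc (1 : ℝ) = k * (1 / k) := by field_simp
      _ ≤ _ := by gcongr
  have hpow_succ : (2 : ℝ) ^ k = 2 ^ (k - 1) * 2 := by
    rw [← pow_succ, Nat.sub_add_cancel hk]
  rw [hpow_succ] at hN
  linarith

theorem exists_isBalanced (hk : 1 ≤ k) :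
    ∃ (n : ℕ) (H : Matrix (Fin k) (Fin n) Bool),
      IsBalanced H ∧ 2 ^ (k - 1) * (1 - 2 / (k : ℝ)) ≤ n := by
  set s := √((k : ℝ) * Real.log k)
  have hcompl (A) (hA : A ∈ balancedSets (Fin k) s) : Aᶜ ∈ balancedSets (Fin k) s :=
    compl_mem_balancedSets hA
  obtain ⟨C, hC, hrows, hred⟩ := exists_injective_hasReducedColumns hcompl
    (fun i i' hne => exists_mem_balancedSets_separating (half_le_sqrt_mul_log (by
      have := Fintype.one_lt_card_iff.2 ⟨i, i', hne⟩
      rwa [Fintype.card_fin] at this)) hne) (rfl : _ = #(representatives _ (⟨0, hk⟩ : Fin k)))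
  refine ⟨_, _, ⟨hrows, hred, fun j => ?_⟩,
    two_pow_mul_one_sub_two_div_le hk (two_pow_mul_le_card_balancedSets hk)
      (card_le_two_mul_card_representatives_add_one hcompl _)⟩
  rw [weight_incidenceMatrix, Nat.cast_min]
  simpa only [Fintype.card_fin, le_min_iff] using mem_balancedSets.1 (hC j)

theorem exists_isExtremal (hk : 1 ≤ k) : ∃ (n : ℕ) (h : BoolFn n), IsExtremal k h := by
  set sizes : Set ℕ := {n | ∃ H : Matrix (Fin k) (Fin n) Bool, IsBalanced H}
  have hne : sizes.Nonempty :=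
    have ⟨n, H, hH, _⟩ := exists_isBalanced hk
    ⟨n, H, hH⟩
  have hbdd : BddAbove sizes :=
    ⟨2 ^ (k - 1) - 1, fun n ⟨_, hH⟩ => hH.columns.le_two_pow_sub_one hk⟩
  obtain ⟨H, hH⟩ := Nat.sSup_mem hne hbdd
  obtain ⟨h, hh⟩ := exists_isZeroMatrix hH.rows
  exact ⟨sSup sizes, h, H, hh, hH, fun n' H' hH' => le_csSup hbdd ⟨H', hH'⟩⟩

variable {n : ℕ} {h : BoolFn n}

theorem IsExtremal.two_pow_mul_le (hh : IsExtremal k h) (hk : 1 ≤ k) :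
    2 ^ (k - 1) * (1 - 2 / (k : ℝ)) ≤ n := by
  obtain ⟨H, -, -, hmax⟩ := hh
  obtain ⟨n', H', hH', hn'⟩ := exists_isBalanced hk
  exact hn'.trans (by exact_mod_cast hmax n' H' hH')

theorem IsExtremal.exists_mem_zeroClass (hh : IsExtremal k h) (hk : 1 ≤ k) :
    ∃ g ∈ zeroClass k (2 ^ (k - 1) - 1), minRank h ≤ minRank g := by
  obtain ⟨H, hH, hbal, -⟩ := hh
  exact hH.exists_mem_zeroClass (hbal.columns.le_two_pow_sub_one hk)

end Extremal

section LowerBound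

theorem mul_le_log_of_two_pow_le {m k : ℕ} (h : 2 ^ m ≤ k) : (m : ℝ) * 0.69 ≤ Real.log k := by
  have hlog := Real.log_le_log (by positivity) (by exact_mod_cast h : (2 : ℝ) ^ m ≤ k)
  rw [Real.log_pow] at hlog
  refine le_trans ?_ hlog
  gcongr
  linarith [Real.log_two_gt_d9]

theorem eight_mul_sqrt_log_le {k : ℕ} (hk : 1 ≤ k)
    (h : 2 * √((k : ℝ) * Real.log k) / (k : ℝ) ≤ 1 / 4) : 8 * √(Real.log k) ≤ √(k : ℝ) := by
  have hk0 : (0 : ℝ) < k := by exact_mod_cast hk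
  have hsq : √(k : ℝ) * √(k : ℝ) = k := Real.mul_self_sqrt hk0.le
  rw [div_le_iff₀ hk0, Real.sqrt_mul hk0.le] at h
  refine le_of_mul_le_mul_left ?_ (Real.sqrt_pos.2 hk0)
  linarith

/-- The inequality `64 * log k ≤ k` bootstraps `k ≥ 2` to `k ≥ 2 ^ 5` and then to `k ≥ 2 ^ 7`. -/
theorem two_pow_seven_le {k : ℕ} (hk : 2 ≤ k) (h : 64 * Real.log k ≤ k) : 2 ^ 7 ≤ k := by
  have hlog₁ := mul_le_log_of_two_pow_le (m := 1) (k := k) (by simpa using hk)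
  have hk₁ : 2 ^ 5 ≤ k := by
    have : (2 ^ 5 : ℝ) ≤ k := by push_cast at hlog₁; linarith
    exact_mod_cast this
  have hlog₅ := mul_le_log_of_two_pow_le hk₁
  have : (2 ^ 7 : ℝ) ≤ k := by push_cast at hlog₅; linarith
  exact_mod_cast this

theorem two_le_sqrt_log {k : ℕ} (hk : 2 ≤ k) (h : 8 * √(Real.log k) ≤ √(k : ℝ)) :
    2 ≤ √(Real.log k) := by
  have h64 : 64 * Real.log k ≤ k := by
    have := mul_self_le_mul_self (by positivity) h
    rw [Real.mul_self_sqrt (Nat.cast_nonneg k), mul_mul_mul_comm,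
      Real.mul_self_sqrt (Real.log_natCast_nonneg k)] at this
    linarith
  have hlog := mul_le_log_of_two_pow_le (two_pow_seven_le hk h64)
  push_cast at hlog
  exact Real.le_sqrt_of_sq_le (by linarith)

theorem HasReducedColumns.two_le_hammingDist {k n : ℕ} {M : Matrix (Fin k) (Fin n) Bool}
    (hM : HasReducedColumns M) (hk : 5 ≤ k)
    (hn : (2 : ℝ) ^ (k - 1) * (1 - 2 / (k : ℝ)) ≤ n) {i i' : Fin k} (hne : i ≠ i') :
    2 ≤ hammingDist (M i) (M i') := by
  by_contra! hlt
  have hle : 4 * n ≤ 2 ^ k + 4 * 1 :=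
    (hM.four_mul_le_add_four_mul_hammingDist hne).trans (by gcongr; omega)
  have hle' : 4 * (n : ℝ) ≤ 2 ^ (k - 1) * 2 + 4 := by
    rw [pow_sub_one_mul (by omega)]
    exact_mod_cast hle
  have hpow : (2 : ℝ) ^ 4 ≤ 2 ^ (k - 1) := pow_le_pow_right₀ one_le_two (by omega)
  have hinv : 2 / (k : ℝ) ≤ 2 / 5 := by
    gcongr
    exact_mod_cast hk
  nlinarith

/-- With `q = √k` and `r = √(log k)`, the balanced columns have weight at least
`k / 2 - q * r`. -/
theorem mul_lt_two_mul_of_eight_mul_le {q r : ℝ} (hr : 2 ≤ r) (hqr : 8 * r ≤ q) :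
    (10 / 3 - 5 / 3 * (2 * r ^ 2 / (q + 2 * r ^ 2))) * (7 * (q ^ 2 / 2 - q * r) - 2 * q ^ 2) <
      2 * (13 * (q ^ 2 / 2 - q * r) - 4 * q ^ 2) := by
  have hq : 0 < q := by linarith
  have hfactor : 10 / 3 - 5 / 3 * (2 * r ^ 2 / (q + 2 * r ^ 2)) =
      10 / 3 * (q + r ^ 2) / (q + 2 * r ^ 2) := by
    field_simp
    ring
  have hpos : 0 < q * r * (5 * (q * r) - 8 / 3 * q - 86 / 3 * r ^ 2) := by
    have : 0 < 5 * (q * r) - 8 / 3 * q - 86 / 3 * r ^ 2 := by nlinarith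
    positivity
  rw [hfactor, div_mul_eq_mul_div, div_lt_iff₀ (by positivity)]
  linarith

theorem IsBalanced.mul_lt_minRank {k n : ℕ} {M : Matrix (Fin k) (Fin n) Bool} {f : BoolFn n}
    (hM : IsBalanced M) (hf : IsZeroMatrix M f)
    (hdist : ∀ i i', i ≠ i' → 2 ≤ hammingDist (M i) (M i')) (hn : 0 < n)
    (h2 : 2 ≤ √(Real.log k)) (h8 : 8 * √(Real.log k) ≤ √(k : ℝ)) :
    (10 / 3 - 5 / 3 * (2 * Real.log k / (√(k : ℝ) + 2 * Real.log k))) * n < minRank f := by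
  have hq : √(k : ℝ) ^ 2 = k := Real.sq_sqrt (Nat.cast_nonneg k)
  have hr : √(Real.log k) ^ 2 = Real.log k := Real.sq_sqrt (Real.log_natCast_nonneg k)
  have hweight := hM.weight_ge
  rw [Real.sqrt_mul (Nat.cast_nonneg k)] at hweight
  have hquad := mul_lt_two_mul_of_eight_mul_le h2 h8
  rw [hq, hr] at hquad
  have hm : 3 / 8 * (k : ℝ) ≤ (k : ℝ) / 2 - √(k : ℝ) * √(Real.log k) := by
    have := mul_le_mul_of_nonneg_left h8 (Real.sqrt_nonneg k)
    rw [← pow_two, hq] at this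
    linarith
  set m := (k : ℝ) / 2 - √(k : ℝ) * √(Real.log k)
  have hk : (0 : ℝ) < k := hq ▸ pow_pos (by linarith) 2
  refine lt_of_mul_lt_mul_left (a := 7 * m - 2 * k) ?_ (by linarith)
  set F := 10 / 3 - 5 / 3 * (2 * Real.log k / (√(k : ℝ) + 2 * Real.log k))
  calc (7 * m - 2 * k) * (F * n) = F * (7 * m - 2 * k) * n := by ring
    _ < 2 * (13 * m - 4 * k) * n := by gcongr
    _ = (13 * m - 4 * k) * (2 * n) := by ring
    _ ≤ (7 * m - 2 * k) * minRank f :=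
        hf.mul_le_mul_minRank hM.columns hdist hweight (by linarith)

theorem IsExtremal.lt_minRank {k n : ℕ} {h : BoolFn n} (hk : 1 ≤ k)
    (hkc : 2 * √((k : ℝ) * Real.log k) / (k : ℝ) ≤ 1 / 4) (hh : IsExtremal k h) :
    (2 : ℝ) ^ (k - 1) *
          (10 / 3 - 5 / 3 * (2 * Real.log k / (√(k : ℝ) + 2 * Real.log k))) *
          (1 - 2 / (k : ℝ)) < minRank h := by
  obtain rfl | hk2 := hk.eq_or_lt
  · refine lt_of_lt_of_le ?_ (Nat.cast_nonneg _)
    norm_num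
  have hn := hh.two_pow_mul_le hk
  obtain ⟨H, hH, hbal, -⟩ := hh
  have h8 := eight_mul_sqrt_log_le hk hkc
  have h2 := two_le_sqrt_log hk2 h8
  have hk5 : (5 : ℝ) ≤ k := by nlinarith [Real.sq_sqrt (Nat.cast_nonneg (α := ℝ) k)]
  have hn0 : 0 < n := by
    have : 2 / (k : ℝ) < 1 := by rw [div_lt_one] <;> linarith
    have : (0 : ℝ) < n := lt_of_lt_of_le (mul_pos (by positivity) (by linarith)) hn
    exact_mod_cast this
  have hdist := fun i i' => hbal.columns.two_le_hammingDist (by exact_mod_cast hk5) hn (i := i)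
    (i' := i')
  have hfactor : 2 * Real.log k / (√(k : ℝ) + 2 * Real.log k) ≤ 1 := by
    have := Real.log_natCast_nonneg k
    refine div_le_one_of_le₀ ?_ ?_ <;> linarith [Real.sqrt_nonneg k]
  refine lt_of_le_of_lt ?_ (hbal.mul_lt_minRank hH hdist hn0 h2 h8)
  rw [mul_comm ((2 : ℝ) ^ (k - 1)), mul_assoc]
  gcongr
  linarith

theorem tendsto_log_div_sqrt : Tendsto (fun k : ℕ => Real.log k / √(k : ℝ)) atTop (𝓝 0) := by
  have := (isLittleO_log_rpow_atTop one_half_pos).tendsto_div_nhds_zero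
  simpa [Function.comp_def, Real.sqrt_eq_rpow] using this.comp tendsto_natCast_atTop_atTop

theorem tendsto_log_div : Tendsto (fun k : ℕ => Real.log k / (k : ℝ)) atTop (𝓝 0) := by
  have := Real.isLittleO_log_id_atTop.tendsto_div_nhds_zero
  exact this.comp tendsto_natCast_atTop_atTop

theorem eventually_two_mul_sqrt_mul_log_div_le :
    ∀ᶠ k : ℕ in atTop, 2 * √((k : ℝ) * Real.log k) / (k : ℝ) ≤ 1 / 4 := by
  filter_upwards [tendsto_log_div.eventually_le_const (by norm_num : (0 : ℝ) < 1 / 64),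
    eventually_gt_atTop 0] with k hlog hk
  have hk0 : (0 : ℝ) < k := by exact_mod_cast hk
  rw [div_le_iff₀ hk0] at hlog ⊢
  have : √((k : ℝ) * Real.log k) ≤ k / 8 := Real.sqrt_le_iff.2 ⟨by positivity, by nlinarith⟩
  linarith

theorem exists_tendsto_zero_of_eventually {P : ℕ → ℝ → Prop} {δ₀ : ℕ → ℝ}
    (hδ₀ : Tendsto δ₀ atTop (𝓝 0)) (hev : ∀ᶠ k in atTop, P k (δ₀ k)) (hex : ∀ k, ∃ d, P k d) :
    ∃ δ : ℕ → ℝ, Tendsto δ atTop (𝓝 0) ∧ ∀ k, P k (δ k) := by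
  classical
  choose d hd using hex
  refine ⟨fun k => if P k (δ₀ k) then δ₀ k else d k, hδ₀.congr' ?_, fun k => ?_⟩
  · filter_upwards [hev] with k hk
    rw [if_pos hk]
  · beta_reduce
    split_ifs with hk
    · exact hk
    · exact hd k

theorem tendsto_two_mul_log_div_sqrt_add :
    Tendsto (fun k : ℕ => 2 * Real.log k / (√(k : ℝ) + 2 * Real.log k)) atTop (𝓝 0) := by
  have hlim := tendsto_log_div_sqrt.const_mul 2
  rw [mul_zero] at hlim
  refine squeeze_zero' (Eventually.of_forall fun k => ?_) ?_ hlim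
  · have := Real.log_natCast_nonneg k
    positivity
  · filter_upwards [eventually_gt_atTop 0] with k hk
    have : 0 < √(k : ℝ) := Real.sqrt_pos.2 (by exact_mod_cast hk)
    have := Real.log_natCast_nonneg k
    rw [← mul_div_assoc]
    gcongr
    linarith

theorem exists_tendsto_lt_minRank_of_isExtremal :
    ∃ δ : ℕ → ℝ, Tendsto δ atTop (𝓝 0) ∧
      ∀ (k n : ℕ) (h : BoolFn n), 1 ≤ k → IsExtremal k h →
        10 / 3 * (2 : ℝ) ^ (k - 1) * (1 + δ k) < minRank h := by
  refine exists_tendsto_zero_of_eventually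
    (P := fun k d => ∀ (n : ℕ) (h : BoolFn n), 1 ≤ k → IsExtremal k h →
      10 / 3 * (2 : ℝ) ^ (k - 1) * (1 + d) < minRank h)
    (δ₀ := fun k => (1 - 1 / 2 * (2 * Real.log k / (√(k : ℝ) + 2 * Real.log k))) *
      (1 - 2 / (k : ℝ)) - 1) ?_ ?_ fun k => ⟨-2, ?_⟩
  · have hinv : Tendsto (fun k : ℕ => 2 / (k : ℝ)) atTop (𝓝 0) :=
      tendsto_const_nhds.div_atTop tendsto_natCast_atTop_atTop
    have hlim := (((tendsto_two_mul_log_div_sqrt_add.const_mul (1 / 2)).const_sub 1).mul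
      (hinv.const_sub 1)).sub_const 1
    rwa [mul_zero, sub_zero, mul_one, sub_self] at hlim
  · filter_upwards [eventually_two_mul_sqrt_mul_log_div_le] with k hkc n h hk hh
    refine lt_of_eq_of_lt ?_ (hh.lt_minRank hk hkc)
    ring
  · intro n h _ _
    refine lt_of_lt_of_le ?_ (Nat.cast_nonneg _)
    norm_num

end LowerBound

section CoverSystems

open Finset

variable {α : Type*} [Fintype α] [DecidableEq α]

/-- A cover by non-empty proper subsets, no two of which are complementary. -/
structure IsProperCover (𝒦 : Finset (Finset α)) : Prop where
  nonempty : ∀ A ∈ 𝒦, A.Nonempty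
  ne_univ : ∀ A ∈ 𝒦, A ≠ univ
  ne_compl : ∀ A ∈ 𝒦, ∀ B ∈ 𝒦, B ≠ Aᶜ
  cover : ∀ i, ∃ A ∈ 𝒦, i ∈ A

/-- `F` contains exactly one set of each pair of complementary non-empty sets; its values on `∅`
and `univ` are irrelevant. -/
def IsOrientation (F : Set (Finset α)) : Prop :=
  ∀ A : Finset α, A.Nonempty → A ≠ univ → (Aᶜ ∈ F ↔ A ∉ F)

/-- A family of proper covers such that every orientation containing none of them contains all
non-empty sets that avoid a certain point. Such a family yields a DNF of the complete function:
its covers are the conjunctions, and the orientations are the points of the Boolean cube. -/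
structure IsCoverSystem (𝒟 : Finset (Finset (Finset α))) : Prop where
  isProperCover : ∀ 𝒦 ∈ 𝒟, IsProperCover 𝒦
  exists_point : ∀ F : Set (Finset α), IsOrientation F → (∀ 𝒦 ∈ 𝒟, ¬ (𝒦 : Set (Finset α)) ⊆ F) →
    ∃ i, ∀ A : Finset α, A.Nonempty → i ∉ A → A ∈ F

variable {k n : ℕ} {M : Matrix (Fin k) (Fin n) Bool}

/-- The conjunction of the literals whose sets of false rows belong to `𝒦`. -/
def coverConj (M : Matrix (Fin k) (Fin n) Bool) (𝒦 : Finset (Finset (Fin k))) : Conj n :=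
  univ.filter fun l => falseRows M l ∈ 𝒦

theorem mem_coverConj {𝒦 : Finset (Finset (Fin k))} {l : Lit n} :
    l ∈ coverConj M 𝒦 ↔ falseRows M l ∈ 𝒦 := by
  simp [coverConj]

/-- The sets of false rows of the literals that hold at `x`. -/
def pointOrientation (M : Matrix (Fin k) (Fin n) Bool) (x : Fin n → Bool) :
    Set (Finset (Fin k)) :=
  falseRows M '' {l | x l.1 = l.2}

theorem falseRows_mem_pointOrientation (hM : HasReducedColumns M) {x : Fin n → Bool} {l : Lit n} :
    falseRows M l ∈ pointOrientation M x ↔ x l.1 = l.2 :=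
  hM.falseRows_injective.mem_set_image

theorem isOrientation_pointOrientation (hM : HasReducedColumns M) (hn : 2 * n + 2 = 2 ^ k)
    (x : Fin n → Bool) : IsOrientation (pointOrientation M x) := by
  intro A hA hA'
  obtain ⟨l, rfl⟩ := hM.exists_falseRows_eq hn hA hA'
  rw [← falseRows_neg, falseRows_mem_pointOrientation hM, falseRows_mem_pointOrientation hM]
  exact Bool.eq_not

theorem IsProperCover.holds_coverConj_iff {𝒦 : Finset (Finset (Fin k))} (h𝒦 : IsProperCover 𝒦)
    (hM : HasReducedColumns M) (hn : 2 * n + 2 = 2 ^ k) {x : Fin n → Bool} :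
    (coverConj M 𝒦).Holds x ↔ (𝒦 : Set (Finset (Fin k))) ⊆ pointOrientation M x := by
  refine ⟨fun h A hA => ?_, fun h l hl => ?_⟩
  · obtain ⟨l, rfl⟩ := hM.exists_falseRows_eq hn (h𝒦.nonempty A hA) (h𝒦.ne_univ A hA)
    exact (falseRows_mem_pointOrientation hM).2 (h l (mem_coverConj.2 hA))
  · exact (falseRows_mem_pointOrientation hM).1 (h (mem_coverConj.1 hl))

theorem IsProperCover.isElementary_coverConj {𝒦 : Finset (Finset (Fin k))}
    (h𝒦 : IsProperCover 𝒦) : (coverConj M 𝒦).IsElementary := fun j hj =>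
  h𝒦.ne_compl _ (mem_coverConj.1 hj.1) _ (mem_coverConj.1 hj.2) (falseRows_neg (j, true))

theorem IsProperCover.not_subset_pointOrientation {𝒦 : Finset (Finset (Fin k))}
    (h𝒦 : IsProperCover 𝒦) (i : Fin k) :
    ¬ (𝒦 : Set (Finset (Fin k))) ⊆ pointOrientation M (M i) := by
  intro h
  obtain ⟨A, hA, hi⟩ := h𝒦.cover i
  obtain ⟨l, hl, rfl⟩ := h hA
  exact mem_falseRows.1 hi hl

theorem row_eq_of_forall_mem_pointOrientation (hM : HasReducedColumns M) {x : Fin n → Bool}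
    {i : Fin k} (h : ∀ A : Finset (Fin k), A.Nonempty → i ∉ A → A ∈ pointOrientation M x) :
    M i = x := by
  funext j
  have hi : i ∉ falseRows M (j, M i j) := by simp [mem_falseRows]
  exact ((falseRows_mem_pointOrientation hM).1 (h _ (hM.falseRows_nonempty _) hi)).symm

variable {𝒟 : Finset (Finset (Finset (Fin k)))} {f : BoolFn n}

theorem IsCoverSystem.realizes (h𝒟 : IsCoverSystem 𝒟) (hf : IsZeroMatrix M f)
    (hM : HasReducedColumns M) (hn : 2 * n + 2 = 2 ^ k) :
    DNF.Realizes (𝒟.image (coverConj M)) f := by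
  simp only [DNF.Realizes, forall_mem_image, exists_mem_image]
  refine ⟨fun 𝒦 h𝒦 => (h𝒟.isProperCover 𝒦 h𝒦).isElementary_coverConj, fun x => ⟨fun hx => ?_, ?_⟩⟩
  · by_contra! hcon
    obtain ⟨i, hi⟩ := h𝒟.exists_point _ (isOrientation_pointOrientation hM hn x) fun 𝒦 h𝒦 =>
      mt ((h𝒟.isProperCover 𝒦 h𝒦).holds_coverConj_iff hM hn).2 (hcon 𝒦 h𝒦)
    obtain rfl := row_eq_of_forall_mem_pointOrientation hM hi
    simp [hf.eq_false i] at hx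
  · rintro ⟨𝒦, h𝒦, hx⟩
    by_contra hfalse
    obtain ⟨i, rfl⟩ := (hf.2 x).1 (Bool.eq_false_iff.2 hfalse)
    have hproper := h𝒟.isProperCover 𝒦 h𝒦
    exact hproper.not_subset_pointOrientation i ((hproper.holds_coverConj_iff hM hn).1 hx)

theorem IsCoverSystem.minRank_le_sum_card (h𝒟 : IsCoverSystem 𝒟) (hf : IsZeroMatrix M f)
    (hM : HasReducedColumns M) (hn : 2 * n + 2 = 2 ^ k) : minRank f ≤ ∑ 𝒦 ∈ 𝒟, #𝒦 :=
  calc minRank f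
      ≤ ∑ K ∈ 𝒟.image (coverConj M), #K := minRank_le (h𝒟.realizes hf hM hn)
    _ ≤ ∑ 𝒦 ∈ 𝒟, #(coverConj M 𝒦) := sum_image_le_of_nonneg fun _ _ => Nat.zero_le _
    _ ≤ ∑ 𝒦 ∈ 𝒟, #𝒦 := sum_le_sum fun _ _ =>
        card_le_card_of_injOn (falseRows M) (fun _ => mem_coverConj.1)
          hM.falseRows_injective.injOn

end CoverSystems

section Shadows

open Finset
open scoped FinsetFamily

variable {α : Type*} [Fintype α]

/-- Hall's theorem applies to every level above the middle one because the local LYM inequality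
bounds the shadow from below. -/
theorem exists_injOn_covBy_of_card_eq {r : ℕ} (hr : Fintype.card α + 1 ≤ 2 * r) :
    ∃ f : Finset α → Finset α, (∀ B, #B = r → f B ⋖ B) ∧ Set.InjOn f {B | #B = r} := by
  classical
  let shadowOf (B : {B : Finset α // #B = r}) : Finset (Finset α) := ∂ {B.1}
  have hall (s : Finset {B : Finset α // #B = r}) : #s ≤ #(s.biUnion shadowOf) := by
    have hshadow : s.biUnion shadowOf = ∂ (s.map (.subtype _)) := by
      ext A
      simp [shadowOf, mem_shadow_iff]
    have hlym := local_lubell_yamamoto_meshalkin_inequality_mul (r := r)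
      (𝒜 := s.map (.subtype _)) (by simp +contextual [Set.Sized])
    rw [card_map, ← hshadow] at hlym
    refine Nat.le_of_mul_le_mul_right (hlym.trans ?_) (by omega : 0 < r)
    gcongr
    omega
  obtain ⟨g, hinj, hg⟩ := (all_card_le_biUnion_card_iff_exists_injective shadowOf).1 hall
  refine ⟨fun B => if hB : #B = r then g ⟨B, hB⟩ else B, fun B hB => ?_, fun B hB B' hB' heq => ?_⟩
  · have := hg ⟨B, hB⟩
    simp only [shadowOf, mem_shadow_iff, mem_singleton, exists_eq_left] at this
    simpa [hB, covBy_iff_exists_erase] using this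
  · rw [Set.mem_ofPred_eq] at hB hB'
    simp only [hB, hB', dite_true] at heq
    simpa using hinj heq

theorem exists_injOn_covBy :
    ∃ f : Finset α → Finset α, (∀ B, B.Nonempty → f B ⋖ B) ∧
      Set.InjOn f {B | Fintype.card α + 1 < 2 * #B} := by
  have hlevel (r : ℕ) : ∃ g : Finset α → Finset α, (∀ B, B.Nonempty → #B = r → g B ⋖ B) ∧
      (Fintype.card α + 1 < 2 * r → Set.InjOn g {B | #B = r}) := by
    by_cases hr : Fintype.card α + 1 < 2 * r
    · obtain ⟨g, hg, hinj⟩ := exists_injOn_covBy_of_card_eq hr.le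
      exact ⟨g, fun B _ => hg B, fun _ => hinj⟩
    · classical
      choose! g hg using fun (B : Finset α) (hB : B.Nonempty) =>
        hB.elim fun b hb => (⟨B.erase b, erase_covBy hb⟩ : ∃ C, C ⋖ B)
      exact ⟨g, fun B hB _ => hg B hB, fun h => absurd h hr⟩
  choose g hg hinj using hlevel
  refine ⟨fun B => g #B B, fun B hB => hg _ B hB rfl, fun B hB B' hB' heq => ?_⟩
  rw [Set.mem_ofPred_eq] at hB hB'
  have hcard : #B = #B' := by
    have hcov := (hg _ B (card_pos.1 (by omega)) rfl).card_finset
    have hcov' := (hg _ B' (card_pos.1 (by omega)) rfl).card_finset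
    rw [Nat.covBy_iff_add_one_eq] at hcov hcov'
    rw [← hcov, ← hcov']
    exact congrArg (#· + 1) heq
  exact hinj _ hB rfl hcard.symm (by simpa [hcard] using heq)

end Shadows

section ChainPartitions

open Finset

variable {α : Type*} [Fintype α] [DecidableEq α]

/-- The partition cut out by the chain `C ⊆ B`. -/
def chainPartition (C B : Finset α) : Finset (Finset α) := {C, B \ C, Bᶜ}

theorem chainPartition_compl_compl (C B : Finset α) :
    chainPartition Bᶜ Cᶜ = chainPartition C B := by
  rw [chainPartition, chainPartition, compl_compl, compl_sdiff_compl, insert_comm, pair_comm,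
    insert_comm]

theorem isProperCover_chainPartition {C B : Finset α} (hC : C.Nonempty) (hCB : C ⊂ B)
    (hB : B ≠ univ) : IsProperCover (chainPartition C B) := by
  obtain ⟨c, hc⟩ := hC
  obtain ⟨b, hbB, hbC⟩ := exists_of_ssubset hCB
  obtain ⟨x, hx⟩ : ∃ x, x ∉ B := by simpa [eq_univ_iff_forall] using hB
  have hcB := hCB.subset hc
  have hxC : x ∉ C := fun h => hx (hCB.subset h)
  have hmem {A : Finset α} : A ∈ chainPartition C B ↔ A = C ∨ A = B \ C ∨ A = Bᶜ := by
    simp [chainPartition]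
  constructor
  · simp only [hmem, forall_eq_or_imp, forall_eq]
    exact ⟨⟨c, hc⟩, ⟨b, by simp [*]⟩, ⟨x, by simp [*]⟩⟩
  · simp only [hmem, forall_eq_or_imp, forall_eq, ne_eq, eq_univ_iff_forall, not_forall]
    exact ⟨⟨b, hbC⟩, ⟨c, by simp [*]⟩, ⟨c, by simp [*]⟩⟩
  · intro A hA A' hA' heq
    have hunion : (c ∈ A ∨ c ∈ A') ∧ (b ∈ A ∨ b ∈ A') ∧ (x ∈ A ∨ x ∈ A') := by simp [heq, em]
    rw [hmem] at hA hA'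
    obtain rfl | rfl | rfl := hA <;> obtain rfl | rfl | rfl := hA' <;>
      simp [hc, hcB, hbB, hbC, hx, hxC] at hunion
  · intro i
    by_cases hi : i ∈ C <;> by_cases hi' : i ∈ B <;> simp [chainPartition, hi, hi']

theorem isProperCover_pair_compl_singleton {a b : α} (hab : a ≠ b) (hα : 3 ≤ Fintype.card α) :
    IsProperCover ({{a}ᶜ, {b}ᶜ} : Finset (Finset α)) := by
  obtain ⟨c, hc⟩ : ∃ c, c ∉ ({a, b} : Finset α) := by
    by_contra! hcon
    have := card_le_card (fun i _ => hcon i : univ ⊆ _)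
    rw [card_univ, card_pair hab] at this
    omega
  have hmem {A : Finset α} : A ∈ ({{a}ᶜ, {b}ᶜ} : Finset (Finset α)) ↔ A = {a}ᶜ ∨ A = {b}ᶜ := by
    simp
  have hcmem {A : Finset α} (hA : A ∈ ({{a}ᶜ, {b}ᶜ} : Finset (Finset α))) : c ∈ A := by
    obtain rfl | rfl := hmem.1 hA <;> simp_all
  refine ⟨fun A hA => ⟨c, hcmem hA⟩, by simp [compl_eq_univ_iff], fun A hA B hB heq => ?_,
    fun i => ?_⟩
  · exact mem_compl.1 (heq ▸ hcmem hB) (hcmem hA)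
  · obtain rfl | hi := eq_or_ne i a
    · exact ⟨{b}ᶜ, by simp [hab]⟩
    · exact ⟨{a}ᶜ, by simp [hi]⟩

theorem IsOrientation.mem_of_singletons_mem {F : Set (Finset α)} (hF : IsOrientation F)
    {𝒯 : Finset (Finset (Finset α))}
    (h𝒯 : ∀ B : Finset α, 2 ≤ #B → B ≠ univ → ∃ C, C ⋖ B ∧ chainPartition C B ∈ 𝒯)
    (h : ∀ 𝒦 ∈ 𝒯, ¬ (𝒦 : Set (Finset α)) ⊆ F) {B : Finset α} (hB : B.Nonempty) (hB' : B ≠ univ)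
    (hsingle : ∀ b ∈ B, {b} ∈ F) : B ∈ F := by
  induction B using Finset.strongInduction with
  | H B ih =>
  obtain hcard | hcard := Nat.lt_or_ge #B 2
  · obtain ⟨b, rfl⟩ := card_eq_one.1 (show #B = 1 by have := hB.card_pos; omega)
    exact hsingle b (mem_singleton_self b)
  obtain ⟨C, hCB, hmem⟩ := h𝒯 B hcard hB'
  obtain ⟨b, hb, rfl⟩ := covBy_iff_exists_erase.1 hCB
  have hC : B.erase b ∈ F := by
    refine ih _ (erase_ssubset hb) ?_ ?_ fun c hc => hsingle c (mem_of_mem_erase hc)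
    · exact card_pos.1 (by rw [card_erase_of_mem hb]; omega)
    · exact fun hu => hB' (univ_subset_iff.1 (hu ▸ erase_subset b B))
  by_contra hBF
  refine h _ hmem ?_
  rw [chainPartition, sdiff_erase_self hb]
  simp [Set.insert_subset_iff, hC, hsingle b hb, hF B hB hB', hBF]

theorem isCoverSystem_union (hα : 3 ≤ Fintype.card α) {𝒯 : Finset (Finset (Finset α))}
    (hproper : ∀ 𝒦 ∈ 𝒯, IsProperCover 𝒦)
    (h𝒯 : ∀ B : Finset α, 2 ≤ #B → B ≠ univ → ∃ C, C ⋖ B ∧ chainPartition C B ∈ 𝒯) :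
    IsCoverSystem (𝒯 ∪ univ.offDiag.image fun p => {{p.1}ᶜ, {p.2}ᶜ}) where
  isProperCover 𝒦 h𝒦 := by
    simp only [mem_union, mem_image, mem_offDiag] at h𝒦
    obtain h𝒦 | ⟨p, hp, rfl⟩ := h𝒦
    · exact hproper 𝒦 h𝒦
    · exact isProperCover_pair_compl_singleton hp.2.2 hα
  exists_point F hF hmiss := by
    have hsingletons {B : Finset α} := hF.mem_of_singletons_mem h𝒯
      (fun 𝒦 h𝒦 => hmiss 𝒦 (mem_union_left _ h𝒦)) (B := B)
    have hcompl (a : α) : {a}ᶜ ∈ F ↔ {a} ∉ F := hF {a} (singleton_nonempty a) <| by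
      rw [ne_eq, ← card_eq_iff_eq_univ, card_singleton]
      omega
    have hpair {a b : α} (hab : a ≠ b) : {a} ∈ F ∨ {b} ∈ F := by
      by_contra! hcon
      refine hmiss {{a}ᶜ, {b}ᶜ} (mem_union_right _ (mem_image.2 ⟨(a, b), by simpa, rfl⟩)) ?_
      simp [Set.insert_subset_iff, hcompl, hcon]
    obtain ⟨i, hi⟩ : ∃ i, {i} ∉ F := by
      by_contra! hall
      have : Nonempty α := Fintype.card_pos_iff.1 (by omega)
      obtain ⟨a⟩ := this
      refine (hcompl a).1 (hsingletons ?_ (by simp) fun b _ => hall b) (hall a)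
      rw [← card_pos, card_compl, card_singleton]
      omega
    refine ⟨i, fun A hA hiA => hsingletons hA (fun h => hiA (h ▸ mem_univ i)) fun b hb => ?_⟩
    exact (hpair (ne_of_mem_of_not_mem hb hiA)).resolve_right hi

end ChainPartitions

section MatchedChains

open Finset

theorem card_add_one_of_covBy {α : Type*} {f : Finset α → Finset α}
    (hf : ∀ B, B.Nonempty → f B ⋖ B) {B : Finset α} (hB : B.Nonempty) : #(f B) + 1 = #B :=
  Nat.covBy_iff_add_one_eq.1 (hf B hB).card_finset

variable {α : Type*} [Fintype α]

/-- The sets above the middle level, or above both middle levels if there are two. -/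
def setsAboveMiddle (α : Type*) [Fintype α] : Finset (Finset α) := {B | Fintype.card α + 1 < 2 * #B}

theorem mem_setsAboveMiddle {B : Finset α} :
    B ∈ setsAboveMiddle α ↔ Fintype.card α + 1 < 2 * #B := by
  simp [setsAboveMiddle]

theorem card_filter_two_mul_card_le_card_add_one (hα : 1 ≤ Fintype.card α) :
    #{B : Finset α | 2 * #B ≤ Fintype.card α + 1} ≤
      2 ^ (Fintype.card α - 1) + (Fintype.card α).choose (Fintype.card α / 2) := by
  classical
  have hsymm : Fintype.card α - (Fintype.card α + 1) / 2 = Fintype.card α / 2 := by omega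
  have hcard (B : Finset α) := card_compl_add_card B
  let lower : Finset (Finset α) := {B | 2 * #B < Fintype.card α}
  have hlower : #lower ≤ #lowerᶜ := by
    refine card_le_card_of_injOn compl (fun B hB => ?_) compl_injective.injOn
    specialize hcard B
    rw [mem_coe, mem_filter_univ] at hB
    rw [mem_coe, mem_compl, mem_filter_univ]
    omega
  have hsum := card_add_card_compl lower
  rw [Fintype.card_finset, ← Nat.two_pow_pred_mul_two (by omega : 0 < Fintype.card α)] at hsum
  calc #{B : Finset α | 2 * #B ≤ Fintype.card α + 1}
      ≤ #(lower ∪ powersetCard ((Fintype.card α + 1) / 2) univ) := by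
        refine card_le_card fun B hB => ?_
        simp only [lower, mem_filter_univ, mem_union, mem_powersetCard_univ] at hB ⊢
        omega
    _ ≤ #lower + (Fintype.card α).choose ((Fintype.card α + 1) / 2) := by
        simpa using card_union_le lower (powersetCard ((Fintype.card α + 1) / 2) univ)
    _ ≤ _ := by
        rw [← Nat.choose_symm (by omega), hsymm]
        gcongr
        omega

variable [DecidableEq α] {f : Finset α → Finset α}

/-- The partitions `chainPartition (f B) B`, without those for which `B` is the complement of
`f B'` for a set `B'` above the middle level: `chainPartition (f B') B'` serves both `B'` and `B`,
by `chainPartition_compl_compl`. -/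
def matchedChains (f : Finset α → Finset α) : Finset (Finset (Finset α)) :=
  ({B | 2 ≤ #B ∧ B ≠ univ ∧ B ∉ (setsAboveMiddle α).image fun B' => (f B')ᶜ} :
    Finset (Finset α)).image fun B => chainPartition (f B) B

theorem mem_matchedChains {𝒦 : Finset (Finset α)} : 𝒦 ∈ matchedChains f ↔
    ∃ B, (2 ≤ #B ∧ B ≠ univ ∧ B ∉ (setsAboveMiddle α).image fun B' => (f B')ᶜ) ∧
      chainPartition (f B) B = 𝒦 := by
  rw [matchedChains, mem_image]
  simp only [mem_filter_univ]

theorem card_le_three_of_mem_matchedChains {𝒦 : Finset (Finset α)} (h𝒦 : 𝒦 ∈ matchedChains f) :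
    #𝒦 ≤ 3 := by
  obtain ⟨B, -, rfl⟩ := mem_matchedChains.1 h𝒦
  exact card_le_three

theorem isProperCover_of_mem_matchedChains (hf : ∀ B, B.Nonempty → f B ⋖ B)
    {𝒦 : Finset (Finset α)} (h𝒦 : 𝒦 ∈ matchedChains f) : IsProperCover 𝒦 := by
  obtain ⟨B, ⟨hcard, hB, -⟩, rfl⟩ := mem_matchedChains.1 h𝒦
  have hne : B.Nonempty := card_pos.1 (by omega)
  have := card_add_one_of_covBy hf hne
  exact isProperCover_chainPartition (card_pos.1 (by omega)) (hf B hne).lt hB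

theorem exists_chainPartition_mem_matchedChains (hf : ∀ B, B.Nonempty → f B ⋖ B) {B : Finset α}
    (hcard : 2 ≤ #B) (hB : B ≠ univ) : ∃ C, C ⋖ B ∧ chainPartition C B ∈ matchedChains f := by
  by_cases himage : B ∈ (setsAboveMiddle α).image fun B' => (f B')ᶜ
  · obtain ⟨B', hB', rfl⟩ := mem_image.1 himage
    rw [mem_setsAboveMiddle] at hB'
    have hne : B'.Nonempty := card_pos.1 (by omega)
    have hcard' := card_add_one_of_covBy hf hne
    have hcompl := card_compl_add_card (f B')
    refine ⟨B'ᶜ, ((apply_covBy_apply_iff (OrderIso.compl (Finset α))).2 (hf B' hne)).ofDual, ?_⟩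
    rw [chainPartition_compl_compl, mem_matchedChains]
    refine ⟨B', ⟨by omega, ?_, ?_⟩, rfl⟩
    · rintro rfl
      rw [card_univ] at hcard'
      omega
    · rw [mem_image]
      rintro ⟨B'', hB'', rfl⟩
      rw [mem_setsAboveMiddle] at hB''
      have := card_add_one_of_covBy hf (B := B'') (card_pos.1 (by omega))
      have := card_compl_add_card (f B'')
      omega
  · exact ⟨f B, hf B (card_pos.1 (by omega)), mem_matchedChains.2 ⟨B, ⟨hcard, hB, himage⟩, rfl⟩⟩

theorem card_matchedChains_le (hinj : Set.InjOn f (setsAboveMiddle α)) :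
    #(matchedChains f) ≤ #{B : Finset α | 2 * #B ≤ Fintype.card α + 1} := by
  have hinj' : Set.InjOn (fun B' => (f B')ᶜ) (setsAboveMiddle α) := compl_injective.comp_injOn hinj
  calc #(matchedChains f)
      ≤ #((setsAboveMiddle α).image fun B' => (f B')ᶜ)ᶜ :=
        card_image_le.trans (card_le_card fun B hB => mem_compl.2 (mem_filter.1 hB).2.2.2)
    _ = #(setsAboveMiddle α)ᶜ := by rw [card_compl, card_compl, card_image_of_injOn hinj']
    _ = #{B : Finset α | 2 * #B ≤ Fintype.card α + 1} := by
        congr 1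
        ext B
        simp [mem_setsAboveMiddle]

theorem exists_isCoverSystem (hα : 3 ≤ Fintype.card α) :
    ∃ 𝒟 : Finset (Finset (Finset α)), IsCoverSystem 𝒟 ∧
      ∑ 𝒦 ∈ 𝒟, #𝒦 ≤ 3 * #{B : Finset α | 2 * #B ≤ Fintype.card α + 1} +
        2 * Fintype.card α ^ 2 := by
  obtain ⟨f, hf, hinj⟩ := exists_injOn_covBy (α := α)
  have hinj' : Set.InjOn f (setsAboveMiddle α) := by simpa [setsAboveMiddle] using hinj
  refine ⟨_, isCoverSystem_union hα (fun _ => isProperCover_of_mem_matchedChains hf)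
    (fun _ => exists_chainPartition_mem_matchedChains hf), ?_⟩
  have hmatched : ∑ 𝒦 ∈ matchedChains f, #𝒦 ≤
      3 * #{B : Finset α | 2 * #B ≤ Fintype.card α + 1} :=
    calc ∑ 𝒦 ∈ matchedChains f, #𝒦 ≤ #(matchedChains f) * 3 :=
          sum_le_card_nsmul _ _ 3 fun _ => card_le_three_of_mem_matchedChains
      _ ≤ _ := by
          rw [mul_comm]
          gcongr
          exact card_matchedChains_le hinj'
  let pairs : Finset (Finset (Finset α)) := univ.offDiag.image fun p => {{p.1}ᶜ, {p.2}ᶜ}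
  have hpairs : ∑ 𝒦 ∈ pairs, #𝒦 ≤ 2 * Fintype.card α ^ 2 :=
    calc ∑ 𝒦 ∈ pairs, #𝒦 ≤ #pairs * 2 := by
          refine sum_le_card_nsmul _ _ 2 fun 𝒦 h𝒦 => ?_
          obtain ⟨p, -, rfl⟩ := mem_image.1 h𝒦
          exact card_le_two
      _ ≤ #(univ : Finset α).offDiag * 2 := by
          gcongr
          exact card_image_le
      _ ≤ _ := by
          rw [offDiag_card, card_univ, ← sq, mul_comm]
          gcongr
          exact Nat.sub_le _ _
  calc ∑ 𝒦 ∈ matchedChains f ∪ pairs, #𝒦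
      ≤ ∑ 𝒦 ∈ matchedChains f, #𝒦 + ∑ 𝒦 ∈ pairs, #𝒦 := by
        rw [← sum_union_inter]
        exact Nat.le_add_right _ _
    _ ≤ _ := add_le_add hmatched hpairs

theorem minRank_le_of_isCompleteFn {k : ℕ} (hk : 3 ≤ k) {φ : BoolFn (2 ^ (k - 1) - 1)}
    (hφ : IsCompleteFn k φ) :
    minRank φ ≤ 3 * (2 ^ (k - 1) + k.choose (k / 2)) + 2 * k ^ 2 := by
  obtain ⟨M, hM, hred⟩ := hφ
  obtain ⟨𝒟, h𝒟, hsum⟩ := exists_isCoverSystem (α := Fin k) (by simpa)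
  have hlow := card_filter_two_mul_card_le_card_add_one (α := Fin k) (by simp; omega)
  rw [Fintype.card_fin] at hsum hlow
  have hvars : 2 * (2 ^ (k - 1) - 1) + 2 = 2 ^ k := by
    have := Nat.two_pow_pred_mul_two (w := k) (by omega)
    have := Nat.one_le_two_pow (n := k - 1)
    omega
  calc minRank φ ≤ ∑ 𝒦 ∈ 𝒟, #𝒦 := h𝒟.minRank_le_sum_card hM hred hvars
    _ ≤ _ := hsum
    _ ≤ _ := by gcongr

end MatchedChains

section UpperBound

theorem centralBinom_sq_mul_le (n : ℕ) : n.centralBinom ^ 2 * (2 * n + 1) ≤ 16 ^ n := by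
  induction n with
  | zero => simp
  | succ n ih =>
    refine le_of_mul_le_mul_left ?_ (pow_pos n.succ_pos 2)
    calc (n + 1) ^ 2 * ((n + 1).centralBinom ^ 2 * (2 * (n + 1) + 1))
        = ((n + 1) * (n + 1).centralBinom) ^ 2 * (2 * n + 3) := by ring
      _ = 4 * (2 * n + 1) * (2 * n + 3) * (n.centralBinom ^ 2 * (2 * n + 1)) := by
          rw [Nat.succ_mul_centralBinom_succ]
          ring
      _ ≤ 16 * (n + 1) ^ 2 * 16 ^ n := Nat.mul_le_mul (by nlinarith) ih
      _ = (n + 1) ^ 2 * 16 ^ (n + 1) := by ring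

theorem choose_half_sq_mul_le (k : ℕ) : k.choose (k / 2) ^ 2 * (k + 1) ≤ 4 ^ k := by
  obtain ⟨n, rfl | rfl⟩ := Nat.even_or_odd' k
  · rw [Nat.mul_div_cancel_left n two_pos, pow_mul]
    exact centralBinom_sq_mul_le n
  · have hcentral : (n + 1).centralBinom = 2 * (2 * n + 1).choose n := by
      rw [Nat.centralBinom, show 2 * (n + 1) = (2 * n + 1) + 1 by ring, Nat.choose_succ_succ,
        Nat.choose_symm_half]
      ring
    have hpow : 16 ^ (n + 1) = 4 ^ (2 * n + 1) * 4 := by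
      rw [← pow_succ, show 2 * n + 1 + 1 = 2 * (n + 1) by ring, pow_mul]
      norm_num
    have hle := centralBinom_sq_mul_le (n + 1)
    rw [hcentral, hpow] at hle
    rw [show (2 * n + 1) / 2 = n by omega]
    nlinarith

theorem choose_half_div_two_pow_le {k : ℕ} (hk : 1 ≤ k) :
    (k.choose (k / 2) : ℝ) / 2 ^ (k - 1) ≤ 2 * √(1 / ((k : ℝ) + 1)) := by
  have hsq : (k.choose (k / 2) : ℝ) ^ 2 * (k + 1) ≤ (2 ^ k) ^ 2 := by
    rw [← pow_mul, mul_comm k, pow_mul]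
    exact_mod_cast choose_half_sq_mul_le k
  calc (k.choose (k / 2) : ℝ) / 2 ^ (k - 1) = 2 * (k.choose (k / 2) / 2 ^ k) := by
        rw [← pow_sub_one_mul (by omega : k ≠ 0)]
        field_simp
    _ ≤ 2 * √(1 / ((k : ℝ) + 1)) := by
        gcongr
        apply Real.le_sqrt_of_sq_le
        rw [div_pow, div_le_div_iff₀ (by positivity) (by positivity), one_mul]
        exact hsq

theorem tendsto_choose_half_div_two_pow :
    Tendsto (fun k : ℕ => (k.choose (k / 2) : ℝ) / 2 ^ (k - 1)) atTop (𝓝 0) := by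
  have hlim := ((Real.continuous_sqrt.tendsto 0).comp
    (tendsto_one_div_add_atTop_nhds_zero_nat (𝕜 := ℝ))).const_mul 2
  rw [Real.sqrt_zero, mul_zero] at hlim
  refine squeeze_zero' (Eventually.of_forall fun k => by positivity) ?_ hlim
  filter_upwards [eventually_ge_atTop 1] with k hk using choose_half_div_two_pow_le hk

theorem exists_tendsto_minRank_le_of_isCompleteFn :
    ∃ δ : ℕ → ℝ, Tendsto δ atTop (𝓝 0) ∧
      ∀ (k : ℕ) (φ : BoolFn (2 ^ (k - 1) - 1)), 1 ≤ k → IsCompleteFn k φ →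
        (minRank φ : ℝ) ≤ 3 * (2 : ℝ) ^ (k - 1) * (1 + δ k) := by
  refine exists_tendsto_zero_of_eventually
    (P := fun k d => ∀ φ : BoolFn (2 ^ (k - 1) - 1), 1 ≤ k → IsCompleteFn k φ →
      (minRank φ : ℝ) ≤ 3 * (2 : ℝ) ^ (k - 1) * (1 + d))
    (δ₀ := fun k => k.choose (k / 2) / 2 ^ (k - 1) + 4 / 3 * ((k : ℝ) ^ 2 / 2 ^ k)) ?_ ?_
    fun k => ⟨∑ φ : BoolFn (2 ^ (k - 1) - 1), (minRank φ : ℝ), fun φ _ _ => ?_⟩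
  · have hlim := tendsto_choose_half_div_two_pow.add
      ((tendsto_pow_const_div_const_pow_of_one_lt 2 (one_lt_two (α := ℝ))).const_mul (4 / 3))
    rwa [mul_zero, add_zero] at hlim
  · filter_upwards [eventually_ge_atTop 3] with k hk φ _ hφ
    calc (minRank φ : ℝ) ≤ 3 * (2 ^ (k - 1) + k.choose (k / 2)) + 2 * (k : ℝ) ^ 2 := by
          exact_mod_cast minRank_le_of_isCompleteFn hk hφ
      _ = _ := by
          rw [← pow_sub_one_mul (by omega : k ≠ 0) (2 : ℝ)]
          field_simp
          ring
  · have hpow : (1 : ℝ) ≤ 2 ^ (k - 1) := one_le_pow₀ one_le_two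
    have hsum : (minRank φ : ℝ) ≤ ∑ φ : BoolFn (2 ^ (k - 1) - 1), (minRank φ : ℝ) :=
      Finset.single_le_sum (fun _ _ => Nat.cast_nonneg _) (Finset.mem_univ φ)
    nlinarith [(minRank φ).cast_nonneg (α := ℝ)]

end UpperBound

theorem eventually_mul_minRank_lt_of_isExtremal {c : ℝ} (hc : c < 10 / 9) :
    ∀ᶠ k : ℕ in atTop, ∀ (n : ℕ) (h : BoolFn n) (φ : BoolFn (2 ^ (k - 1) - 1)),
      IsExtremal k h → IsCompleteFn k φ → c * (minRank φ : ℝ) < minRank h := by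
  obtain ⟨δ, hδ, hlow⟩ := exists_tendsto_lt_minRank_of_isExtremal
  obtain ⟨ε, hε, hup⟩ := exists_tendsto_minRank_le_of_isCompleteFn
  have hc' : max c 0 < 10 / 9 := max_lt hc (by norm_num)
  have hlim : Tendsto (fun k => 10 / 3 * (1 + δ k) - max c 0 * (3 * (1 + ε k))) atTop
      (𝓝 (10 / 3 * (1 + 0) - max c 0 * (3 * (1 + 0)))) :=
    ((hδ.const_add 1).const_mul _).sub (((hε.const_add 1).const_mul _).const_mul _)
  filter_upwards [hlim.eventually (lt_mem_nhds (a := 0) (by linarith)), eventually_ge_atTop 1]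
    with k hgap hk n h φ hh hφ
  have hpow : (0 : ℝ) < 2 ^ (k - 1) := by positivity
  calc c * (minRank φ : ℝ) ≤ max c 0 * minRank φ := by
        gcongr
        exact le_max_left _ _
    _ ≤ max c 0 * (3 * (2 : ℝ) ^ (k - 1) * (1 + ε k)) := by
        gcongr
        exact hup k φ hk hφ
    _ ≤ 10 / 3 * (2 : ℝ) ^ (k - 1) * (1 + δ k) := by nlinarith
    _ < minRank h := hlow k n h hk hh

theorem mainTheorem3 :
    -- the functions `h` and the complete functions exist
    (∀ k : ℕ, 1 ≤ k → ∃ (n : ℕ) (h : BoolFn n), IsExtremal k h) ∧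
    (∀ k : ℕ, 1 ≤ k → ∃ φ : BoolFn (2 ^ (k - 1) - 1), IsCompleteFn k φ) ∧
    -- the number of columns of the zero matrix of `h`
    (∀ (k n : ℕ) (h : BoolFn n), 1 ≤ k → IsExtremal k h →
      (2 : ℝ) ^ (k - 1) * (1 - 2 / (k : ℝ)) ≤ n) ∧
    -- the explicit lower bound for `h`
    (∀ (k n : ℕ) (h : BoolFn n), 1 ≤ k →
      2 * √((k : ℝ) * Real.log k) / (k : ℝ) ≤ 1 / 4 → IsExtremal k h →
      (2 : ℝ) ^ (k - 1) *
          (10 / 3 - 5 / 3 * (2 * Real.log k / (√(k : ℝ) + 2 * Real.log k))) *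
          (1 - 2 / (k : ℝ)) < minRank h) ∧
    -- the asymptotic lower bound for `h`
    (∃ δ : ℕ → ℝ, Tendsto δ atTop (𝓝 0) ∧
      ∀ (k n : ℕ) (h : BoolFn n), 1 ≤ k → IsExtremal k h →
        10 / 3 * (2 : ℝ) ^ (k - 1) * (1 + δ k) < minRank h) ∧
    -- the upper bound for complete functions
    (∃ δ : ℕ → ℝ, Tendsto δ atTop (𝓝 0) ∧
      ∀ (k : ℕ) (φ : BoolFn (2 ^ (k - 1) - 1)), 1 ≤ k → IsCompleteFn k φ →
        (minRank φ : ℝ) ≤ 3 * (2 : ℝ) ^ (k - 1) * (1 + δ k)) ∧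
    -- `h` is more complex than the complete function with the same number of zeros
    (∀ c : ℝ, c < 10 / 9 → ∀ᶠ k : ℕ in atTop,
      ∀ (n : ℕ) (h : BoolFn n) (φ : BoolFn (2 ^ (k - 1) - 1)),
        IsExtremal k h → IsCompleteFn k φ → c * (minRank φ : ℝ) < minRank h) ∧
    -- the complete function is not the most complex one in its class, even asymptotically
    (∃ δ : ℕ → ℝ, Tendsto δ atTop (𝓝 0) ∧
      ∀ k : ℕ, 1 ≤ k → ∃ g ∈ zeroClass k (2 ^ (k - 1) - 1),
        10 / 3 * (2 : ℝ) ^ (k - 1) * (1 + δ k) < minRank g) ∧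
    (∀ c : ℝ, c < 10 / 9 → ∀ᶠ k : ℕ in atTop,
      ∃ g ∈ zeroClass k (2 ^ (k - 1) - 1), ∀ φ : BoolFn (2 ^ (k - 1) - 1),
        IsCompleteFn k φ → c * (minRank φ : ℝ) < minRank g) := by
  refine ⟨fun k hk => exists_isExtremal hk, fun k hk => exists_isCompleteFn hk,
    fun k n h hk hh => hh.two_pow_mul_le hk, fun k n h hk hc hh => hh.lt_minRank hk hc,
    exists_tendsto_lt_minRank_of_isExtremal, exists_tendsto_minRank_le_of_isCompleteFn,
    fun c hc => eventually_mul_minRank_lt_of_isExtremal hc, ?_, ?_⟩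
  · obtain ⟨δ, hδ, hlow⟩ := exists_tendsto_lt_minRank_of_isExtremal
    refine ⟨δ, hδ, fun k hk => ?_⟩
    obtain ⟨n, h, hh⟩ := exists_isExtremal hk
    obtain ⟨g, hg, hle⟩ := hh.exists_mem_zeroClass hk
    exact ⟨g, hg, (hlow k n h hk hh).trans_le (by exact_mod_cast hle)⟩
  · intro c hc
    filter_upwards [eventually_mul_minRank_lt_of_isExtremal hc, eventually_ge_atTop 1]
      with k hlt hk
    obtain ⟨n, h, hh⟩ := exists_isExtremal hk
    obtain ⟨g, hg, hle⟩ := hh.exists_mem_zeroClass hk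
    exact ⟨g, hg, fun φ hφ => (hlt n h φ hh hφ).trans_le (by exact_mod_cast hle)⟩
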